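/- Let $\tilde\alpha\in\mathbb R$, and let $\Delta^{(\tilde\alpha)}$ be the lower triangular infinite matrix with entries $\Delta^{(\tilde\alpha)}_{nk}=(-1)^{n-k}\binom{\tilde\alpha}{n-k}$ for $0\le k\le n$ and $0$ for $k>n$, where $\binom{\tilde\alpha}{i}=\frac{\tilde\alpha(\tilde\alpha-1)\cdots(\tilde\alpha-i+1)}{i!}$, which equals $\frac{\Gamma(\tilde\alpha+1)}{i!\,\Gamma(\tilde\alpha-i+1)}$ if $\tilde\alpha\notin\mathbb Z$. For $X\in\{\ell_\infty,c_0,c\}$ (spaces of complex sequences indexed by $\mathbb N_0$) let $X(\Delta^{(\tilde\alpha)})=\{x:\Delta^{(\tilde\alpha)}x\in X\}$ with the norm $\|x\|=\sup_n|(\Delta^{(\tilde\alpha)}x)_n|$. Let $Y\in\{\ell_\infty,c_0,c,\ell_1\}$ with its usual norm. For an infinite complex matrix $A=(a_{nk})_{n,k\ge0}$ write $A\in(X(\Delta^{(\tilde\alpha)}),Y)$ if for every $x\in X(\Delta^{(\tilde\alpha)})$ all the series $\sum_k a_{nk}x_k$ converge and $L_A(x):=Ax=(\sum_k a_{nk}x_k)_n\in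 Y$. For a bounded subset $Q$ of a metric space let $\chi(Q)$ be the infimum of all $\varepsilon>0$ such that $Q$ is covered by finitely many open balls of that space of radii less than $\varepsilon$. An operator $L$ between normed spaces is $\chi$-bounded if it maps bounded sets to bounded sets and there is $C>0$ with $\chi(L(Q))\le C\chi(Q)$ for all bounded $Q$; then $\|L\|_\chi=\inf\{C\ge 0:\chi(L(Q))\le C\chi(Q)\text{ for all bounded }Q\}$. Write $S=(s_{jk})=\Delta^{(-\tilde\alpha)}$ and $$\hat a_{nk}=\sum_{j=k}^\infty s_{jk}a_{nj},\quad w^{(A_n)}_{mk}=\sum_{j=m}^\infty s_{jk}a_{nj}\ (k\le m),\quad \gamma_n=\lim_{m\to\infty}\sum_{k=0}^m w^{(A_n)}_{mk},\quad \hat\alpha_k=\lim_{n\to\infty}\hat a_{nk},$$ $$\beta=\lim_{n\to\infty}\Bigl(\sum_{k=0}^\infty\hat a_{nk}-\gamma_n\Bigr),\quad \hat b_{nk}=\hat a_{nk}-\hat\alpha_k,\quad \delta_n=\sum_{k=0}^\infty\hat\alpha_k-\gamma_n-\beta .$$ For a matrix $M$ with rows $M_n$ and $r\in\mathbb N_0$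 let $M^{[r]}$ be the matrix with rows $M^{[r]}_n=0$ for $n\le r$ and $M^{[r]}_n=M_n$ for $n>r$; similarly $\gamma^{[r]}_n=0$ for $n\le r$ and $\gamma^{[r]}_n=\gamma_n$ for $n>r$. Let $\|x\|_1=\sum_k|x_k|$ and $\|M\|_{(\ell_\infty,\ell_\infty)}=\sup_n\|M_n\|_1$. Then the following hold. In each case $L_A$ is $\chi$-bounded, the series and limits that define the quantities involved converge, and the limits over $r$ exist and are finite. (a) Let $A\in(X(\Delta^{(\tilde\alpha)}),Y)$ with $X=\ell_\infty$ or $X=c_0$. 1. If $Y=\ell_\infty$: $\;0\le\|L_A\|_\chi\le\lim_{r\to\infty}\sup_{n\ge r}\sum_k|\hat a_{nk}|$. 3. If $Y=c_0$: $\;\|L_A\|_\chi=\lim_{r\to\infty}\|\hat A^{[r]}\|_{(\ell_\infty,\ell_\infty)}$. 5. If $Y=c$: $\;\frac12\lim_{r\to\infty}\|\hat B^{[r]}\|_{(\ell_\infty,\ell_\infty)}\le\|L_A\|_\chi\le\lim_{r\to\infty}\|\hat B^{[r]}\|_{(\ell_\infty,\ell_\infty)}$. 7. If $Y=\ell_1$: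 $\;\lim_{r\to\infty}\sup_{N}\bigl\|\sum_{n\in N}\hat A^{[r]}_n\bigr\|_1\le\|L_A\|_\chi\le4\lim_{r\to\infty}\sup_{N}\bigl\|\sum_{n\in N}\hat A^{[r]}_n\bigr\|_1$, the suprema being over all finite $N\subset\mathbb N_0$. (b) Let $A\in(c(\Delta^{(\tilde\alpha)}),Y)$. 2. If $Y=\ell_\infty$: $\;0\le\|L_A\|_\chi\le\lim_{r\to\infty}\sup_{n\ge r}\bigl(\sum_k|\hat a_{nk}|+|\gamma_n|\bigr)$. 4. If $Y=c_0$: $\;\|L_A\|_\chi=\lim_{r\to\infty}\sup_{n\ge r}\bigl(\sum_k|\hat a_{nk}|+|\gamma_n|\bigr)$. 6. If $Y=c$: $\;\frac12\lim_{r\to\infty}\sup_{n\ge r}\bigl(\sum_k|\hat b_{nk}|+|\delta_n|\bigr)\le\|L_A\|_\chi\le\lim_{r\to\infty}\sup_{n\ge r}\bigl(\sum_k|\hat b_{nk}|+|\delta_n|\bigr)$. 8. If $Y=\ell_1$: $\;l\le\|L_A\|_\chi\le4l$ with $l=\lim_{r\to\infty}\sup_{N}\bigl(\bigl\|\sum_{n\in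 N}\hat A^{[r]}_n\bigr\|_1+\bigl|\sum_{n\in N}\gamma^{[r]}_n\bigr|\bigr)$, the supremum being over all finite $N\subset\mathbb N_0$. -/

import Mathlib

open Filter Topology
open scoped NNReal ENNReal

noncomputable section

namespace FracSeq

/-- The space `ω` of all complex sequences. -/
abbrev Seq : Type := ℕ → ℂ

/-- Infinite complex matrices. -/
abbrev Mat : Type := ℕ → ℕ → ℂ

/-! ### Series, in the sense of (possibly conditional) convergence of partial sums -/

/-- The series `∑ f k` converges. -/
def SeriesConverges (f : Seq) : Prop :=
  ∃ s : ℂ, Tendsto (fun N => ∑ k ∈ Finset.range N, f k) atTop (𝓝 s)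

/-- The sum of the series `∑ f k`. -/
def seriesSum (f : Seq) : ℂ :=
  limUnder atTop (fun N => ∑ k ∈ Finset.range N, f k)

/-! ### The classical sequence spaces -/

/-- The Banach space `ℓ_p` of complex sequences. -/
abbrev LP (p : ℝ≥0∞) : Type := lp (fun _ : ℕ => ℂ) p

/-- `ℓ_∞`, with the supremum norm. -/
abbrev linf : Submodule ℂ (LP ∞) := ⊤

/-- `ℓ_1`, with its usual norm. -/
abbrev l1 : Submodule ℂ (LP 1) := ⊤

/-- The convergent sequences, with the supremum norm. -/
def conv : Submodule ℂ (LP ∞) where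
  carrier := {x | ∃ l : ℂ, Tendsto (fun n => x n) atTop (𝓝 l)}
  add_mem' := by
    rintro x y ⟨l, hl⟩ ⟨m, hm⟩
    exact ⟨l + m, hl.add hm⟩
  zero_mem' := ⟨0, tendsto_const_nhds⟩
  smul_mem' := by
    rintro a x ⟨l, hl⟩
    exact ⟨a * l, hl.const_mul a⟩

/-- The null sequences, with the supremum norm. -/
def null : Submodule ℂ (LP ∞) where
  carrier := {x | Tendsto (fun n => x n) atTop (𝓝 0)}
  add_mem' := by
    intro x y hx hy
    simpa using Tendsto.add hx hy
  zero_mem' := tendsto_const_nhds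
  smul_mem' := by
    intro a x hx
    simpa using Tendsto.const_mul a hx

/-- A subspace of `ℓ_p`, viewed as a subspace of `ω`. -/
def seqs {p : ℝ≥0∞} (X : Submodule ℂ (LP p)) : Submodule ℂ Seq where
  carrier := {x | ∃ y ∈ X, (fun n => y n) = x}
  add_mem' := by
    rintro _ _ ⟨x, hx, rfl⟩ ⟨y, hy, rfl⟩
    exact ⟨x + y, X.add_mem hx hy, rfl⟩
  zero_mem' := ⟨0, X.zero_mem, rfl⟩
  smul_mem' := by
    rintro a _ ⟨x, hx, rfl⟩
    exact ⟨a • x, X.smul_mem a hx, rfl⟩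

/-! ### The fractional difference operator -/

/-- The entries of the fractional difference matrix of order `α`:
`(-1)^(n-k) * binom(α, n-k)` for `k ≤ n`, and `0` for `k > n`. -/
def fracDiff (α : ℝ) (n k : ℕ) : ℝ :=
  if k ≤ n then (-1) ^ (n - k) * Ring.choose α (n - k) else 0

theorem choose_succ_mul (α : ℝ) (i : ℕ) :
    Ring.choose α (i + 1) * (i + 1) = Ring.choose α i * (α - i) := by
  have h := Ring.choose_smul_choose α (Nat.le_succ i)
  have e : i.succ - i = 1 := by omega
  rw [e, Ring.choose_one_right, Nat.succ_eq_add_one, Nat.choose_succ_self_right] at h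
  rw [← h, nsmul_eq_mul]
  push_cast
  ring

/-- The generalized binomial coefficient as the quotient of Gamma values. -/
theorem choose_eq_Gamma (α : ℝ) (hα : ∀ m : ℤ, α ≠ m) (i : ℕ) :
    Ring.choose α i = Real.Gamma (α + 1) / (i.factorial * Real.Gamma (α - i + 1)) := by
  have hG : ∀ j : ℤ, Real.Gamma (α - j) ≠ 0 := fun j => Real.Gamma_ne_zero (fun m h =>
    hα (j - m) (by push_cast; linarith))
  induction i with
  | zero =>
    have := hG (-1)
    simp only [Int.cast_neg, Int.cast_one, sub_neg_eq_add] at this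
    simp [this]
  | succ i ih =>
    have h1 := choose_succ_mul α i
    have h2 : α - i ≠ 0 := fun h => hα i (by push_cast; linarith)
    have h3 : Real.Gamma (α - i + 1) = (α - i) * Real.Gamma (α - i) := Real.Gamma_add_one h2
    have h4 : Real.Gamma (α - i) ≠ 0 := by simpa using hG i
    have h5 : (i : ℝ) + 1 ≠ 0 := by positivity
    have h6 : (i.factorial : ℝ) ≠ 0 := by positivity
    rw [ih, h3] at h1
    rw [Nat.factorial_succ]
    push_cast
    have h7 : α - (i + 1 : ℝ) + 1 = α - i := by ring
    rw [h7, eq_div_iff (by positivity)]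
    field_simp at h1
    linear_combination h1

/-- Away from the poles the entries are those of the usual Gamma-function formula. -/
theorem fracDiff_eq_Gamma (α : ℝ) (hα : ∀ m : ℤ, α ≠ m) (n k : ℕ) (h : k ≤ n) :
    fracDiff α n k = (-1) ^ (n - k) *
      (Real.Gamma (α + 1) / ((n - k).factorial * Real.Gamma (α - n + k + 1))) := by
  rw [fracDiff, if_pos h, choose_eq_Gamma α hα, Nat.cast_sub h]
  congr 4
  ring

/-- The operator `x ↦ Δ^(α) x` on `ω`. -/
def Delta (α : ℝ) : Seq →ₗ[ℂ] Seq where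
  toFun x n := ∑ k ∈ Finset.range (n + 1), (fracDiff α n k : ℂ) * x k
  map_add' x y := by
    ext n
    simp [mul_add, Finset.sum_add_distrib]
  map_smul' a x := by
    ext n
    simp [Finset.mul_sum, mul_left_comm]

theorem Delta_injective (α : ℝ) : Function.Injective (Delta α) := by
  rw [injective_iff_map_eq_zero]
  intro x hx
  ext n
  induction n using Nat.strong_induction_on with
  | _ n ih =>
    have h : (∑ k ∈ Finset.range (n + 1), (fracDiff α n k : ℂ) * x k) = 0 := congrFun hx n
    rw [Finset.sum_range_succ, Finset.sum_eq_zero] at h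
    · simpa [fracDiff] using h
    · intro k hk
      rw [ih k (Finset.mem_range.1 hk)]
      simp

/-- The matrix domain `X(Δ^(α)) = {x ∈ ω : Δ^(α) x ∈ X}`. -/
def fracDomain (α : ℝ) (X : Submodule ℂ (LP ∞)) : Submodule ℂ Seq :=
  (seqs X).comap (Delta α)

/-- `X(Δ^(α))` as a type, to carry the norm `‖x‖ = ‖Δ^(α) x‖_∞`. -/
def FracSpace (α : ℝ) (X : Submodule ℂ (LP ∞)) : Type := fracDomain α X

namespace FracSpace

variable {α : ℝ} {X : Submodule ℂ (LP ∞)}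

/-- The underlying sequence. -/
def seq (x : FracSpace α X) : Seq := Subtype.val x

theorem seq_mem (x : FracSpace α X) : x.seq ∈ fracDomain α X := Subtype.property x

instance : AddCommGroup (FracSpace α X) := inferInstanceAs (AddCommGroup (fracDomain α X))

instance : Module ℂ (FracSpace α X) := inferInstanceAs (Module ℂ (fracDomain α X))

/-- The transform `x ↦ Δ^(α) x`, with values in `ℓ_∞`. -/
def transform : FracSpace α X →ₗ[ℂ] LP ∞ where
  toFun x := Classical.choose x.seq_mem
  map_add' x y := by
    refine lp.ext ?_
    rw [lp.coeFn_add]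
    refine (Classical.choose_spec (x + y).seq_mem).2.trans ?_
    refine Eq.trans ?_ (congrArg₂ (· + ·) (Classical.choose_spec x.seq_mem).2
      (Classical.choose_spec y.seq_mem).2).symm
    exact map_add (Delta α) x.seq y.seq
  map_smul' a x := by
    refine lp.ext ?_
    rw [lp.coeFn_smul]
    refine (Classical.choose_spec (a • x).seq_mem).2.trans ?_
    refine Eq.trans ?_ (congrArg (a • ·) (Classical.choose_spec x.seq_mem).2).symm
    exact map_smul (Delta α) a x.seq

theorem transform_apply (x : FracSpace α X) (n : ℕ) : transform x n = Delta α x.seq n :=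
  congrFun (Classical.choose_spec x.seq_mem).2 n

theorem transform_injective : Function.Injective (transform : FracSpace α X →ₗ[ℂ] LP ∞) := by
  intro x y h
  refine Subtype.ext (Delta_injective α (funext fun n => ?_))
  exact (transform_apply x n).symm.trans ((congrArg (fun z : LP ∞ => z n) h).trans
    (transform_apply y n))

instance : NormedAddCommGroup (FracSpace α X) :=
  NormedAddCommGroup.induced (FracSpace α X) (LP ∞) transform transform_injective

theorem norm_eq_iSup (x : FracSpace α X) : ‖x‖ = ⨆ n, ‖Delta α x.seq n‖ := by
  refine (lp.norm_eq_ciSup (transform x)).trans ?_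
  simp only [transform_apply]

end FracSpace

/-! ### Matrix transformations -/

/-- `A x`, whose `n`-th term is the sum of the series `∑ a_nk x_k`. -/
def matApply (A : Mat) (x : Seq) : Seq := fun n => seriesSum (fun k => A n k * x k)

/-- The class `(V, W)` of all matrices that map `V` into `W`. -/
def matClass (V W : Submodule ℂ Seq) : Set Mat :=
  {A | ∀ x ∈ V, (∀ n, SeriesConverges (fun k => A n k * x k)) ∧ matApply A x ∈ W}

/-- The operator `L_A : X(Δ^(α)) → Y`, `L_A x = A x`, of a matrix `A ∈ (X(Δ^(α)), Y)`. -/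
def matOp {α : ℝ} {X : Submodule ℂ (LP ∞)} {p : ℝ≥0∞} {Y : Submodule ℂ (LP p)} {A : Mat}
    (hA : A ∈ matClass (fracDomain α X) (seqs Y)) (x : FracSpace α X) : Y :=
  ⟨Classical.choose (hA x.seq x.seq_mem).2, (Classical.choose_spec (hA x.seq x.seq_mem).2).1⟩

theorem matOp_apply {α : ℝ} {X : Submodule ℂ (LP ∞)} {p : ℝ≥0∞} {Y : Submodule ℂ (LP p)} {A : Mat}
    (hA : A ∈ matClass (fracDomain α X) (seqs Y)) (x : FracSpace α X) (n : ℕ) :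
    (matOp hA x : LP p) n = matApply A x.seq n :=
  congrFun (Classical.choose_spec (hA x.seq x.seq_mem).2).2 n

/-! ### The Hausdorff measure of noncompactness -/

/-- The Hausdorff measure of noncompactness of a bounded set `Q`: the infimum of all `ε > 0` such
that `Q` is covered by finitely many open balls of radii less than `ε`. -/
def chi {E : Type*} [PseudoMetricSpace E] (Q : Set E) : ℝ :=
  sInf {ε : ℝ | 0 < ε ∧ ∃ (n : ℕ) (c : Fin n → E) (d : Fin n → ℝ),
    (∀ i, d i < ε) ∧ Q ⊆ ⋃ i, Metric.ball (c i) (d i)}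

/-- `L` maps bounded sets to bounded sets, and `χ(L(Q)) ≤ C χ(Q)` for some `C > 0` and all
bounded `Q`. -/
def ChiBounded {E F : Type*} [PseudoMetricSpace E] [PseudoMetricSpace F] (L : E → F) : Prop :=
  (∀ Q : Set E, Bornology.IsBounded Q → Bornology.IsBounded (L '' Q)) ∧
    ∃ C : ℝ, 0 < C ∧ ∀ Q : Set E, Bornology.IsBounded Q → chi (L '' Q) ≤ C * chi Q

/-- The Hausdorff measure of noncompactness `‖L‖_χ` of a (`χ`-bounded) operator. -/
def chiNorm {E F : Type*} [PseudoMetricSpace E] [PseudoMetricSpace F] (L : E → F) : ℝ :=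
  sInf {C : ℝ | 0 ≤ C ∧ ∀ Q : Set E, Bornology.IsBounded Q → chi (L '' Q) ≤ C * chi Q}

/-! ### The quantities in the estimates -/

/-- `â_nk = ∑_{j ≥ k} s_jk a_nj`, where `S = (s_jk)` is the difference matrix of order `-α`. -/
def hat (α : ℝ) (A : Mat) : Mat := fun n k =>
  seriesSum (fun i => (fracDiff (-α) (k + i) k : ℂ) * A n (k + i))

/-- The entries `w_mk = ∑_{j ≥ m} s_jk a_nj` (`k ≤ m`) of the triangle that belongs to the `n`-th
row of `A`. -/
def tri (α : ℝ) (A : Mat) (n m k : ℕ) : ℂ :=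
  if k ≤ m then seriesSum (fun i => (fracDiff (-α) (m + i) k : ℂ) * A n (m + i)) else 0

/-- `γ_n = lim_m ∑_{k ≤ m} w_mk`. -/
def gam (α : ℝ) (A : Mat) : Seq := fun n =>
  limUnder atTop (fun m => ∑ k ∈ Finset.range (m + 1), tri α A n m k)

/-- `α̂_k = lim_n â_nk`. -/
def hatLim (α : ℝ) (A : Mat) : Seq := fun k => limUnder atTop (fun n => hat α A n k)

/-- `β = lim_n (∑_k â_nk - γ_n)`. -/
def bet (α : ℝ) (A : Mat) : ℂ :=
  limUnder atTop (fun n => seriesSum (hat α A n) - gam α A n)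

/-- `b̂_nk = â_nk - α̂_k`. -/
def hatB (α : ℝ) (A : Mat) : Mat := fun n k => hat α A n k - hatLim α A k

/-- `δ_n = ∑_k α̂_k - γ_n - β`. -/
def del (α : ℝ) (A : Mat) : Seq := fun n => seriesSum (hatLim α A) - gam α A n - bet α A

/-- The series defining `â_nk` and `w_mk` converge. -/
def HatExists (α : ℝ) (A : Mat) : Prop :=
  ∀ n k m, SeriesConverges (fun i => (fracDiff (-α) (m + i) k : ℂ) * A n (m + i))

/-- The limits defining `γ_n` exist. -/
def GamExists (α : ℝ) (A : Mat) : Prop :=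
  ∀ n, ∃ g : ℂ, Tendsto (fun m => ∑ k ∈ Finset.range (m + 1), tri α A n m k) atTop (𝓝 g)

/-- The limits defining `α̂_k` exist. -/
def HatLimExists (α : ℝ) (A : Mat) : Prop :=
  ∀ k, ∃ l : ℂ, Tendsto (fun n => hat α A n k) atTop (𝓝 l)

/-- The series `∑_k â_nk` and `∑_k α̂_k` converge and the limit defining `β` exists. -/
def BetExists (α : ℝ) (A : Mat) : Prop :=
  (∀ n, SeriesConverges (hat α A n)) ∧ SeriesConverges (hatLim α A) ∧
    ∃ b : ℂ, Tendsto (fun n => seriesSum (hat α A n) - gam α A n) atTop (𝓝 b)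

/-- `‖x‖_1 = ∑ |x_k|`, with value `∞` if the series diverges. -/
def norm1 (x : Seq) : ℝ≥0∞ := ∑' k, ‖x k‖ₑ

/-- The truncation written `[r]`: the terms with index `n ≤ r` are replaced by zero. It is applied to
a matrix (as the sequence of its rows) and to a scalar sequence. -/
def cut {M : Type*} [Zero M] (A : ℕ → M) (r : ℕ) : ℕ → M := fun n => if n ≤ r then 0 else A n

/-- `‖M‖_{(ℓ_∞, ℓ_∞)} = sup_n ∑_k |m_nk|`. -/
def normInfInf (M : Mat) : ℝ≥0∞ := ⨆ n, norm1 (M n)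

end FracSeq

end

noncomputable section

namespace FracSeq

/-! ### The Hausdorff measure of noncompactness -/

section Chi

variable {E F : Type*}

/-! Since `Δ^(α)` is invertible with inverse `Δ^(-α)`, it is an isometry of `X(Δ^(α))` onto `X`
(`fracEquiv`), and `chiNorm` is invariant under isometries of the domain. So `L_A` may be replaced
by an operator `X → Y` whose coordinates are functionals `φ n`, the rows of `A` read as functions of
`Δ^(α) x`. These are continuous by Banach–Steinhaus, and the operator itself is continuous by the
closed graph theorem.

For a continuous linear `T`, `chiNorm T` is the measure of noncompactness of the image of the unit
ball (`chiNorm_clm`). Upper bounds come from subtracting a finite-rank operator that reproduces the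
first coordinates (and, for `Y = c`, the limit). Lower bounds come from `eventually_le_of_chi_lt`:
tail functionals that are Lipschitz and tend to zero pointwise are uniformly small on a set covered
by finitely many small balls. The result is a limit of tail suprema of `‖φ n‖`, of `‖φ n - ψ‖` with
`ψ` the pointwise limit, or of `‖∑ φ n‖` over finite sets.

It remains to compute dual norms. If a functional is given by a series, its norm is the `ℓ_1` norm
of its values on the unit sequences, and for a row these values are `â_nk`. On `c_0` every
functional is of this kind. On `ℓ_∞` this needs an argument: the rows and their limits are pointwise
limits of series functionals, and a Baire category argument keeps such limits in the class
(`isSeries_linf_of_tendsto`). On `c` there is one further term, the part at infinity, which for the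
`n`-th row is `γ_n`. -/

theorem chi_nonneg [PseudoMetricSpace E] (Q : Set E) : 0 ≤ chi Q :=
  Real.sInf_nonneg fun _ h => h.1.le

theorem chi_le_of_cover [PseudoMetricSpace E] {ι : Type*} [Finite ι] {Q : Set E} {ε : ℝ}
    (hε : 0 < ε) (c : ι → E) (d : ι → ℝ) (hd : ∀ i, d i < ε)
    (hQ : Q ⊆ ⋃ i, Metric.ball (c i) (d i)) : chi Q ≤ ε := by
  obtain ⟨n, ⟨e⟩⟩ := Finite.exists_equiv_fin ι
  refine csInf_le ⟨0, fun _ h => h.1.le⟩ ⟨hε, n, c ∘ e.symm, d ∘ e.symm, fun i => hd _, ?_⟩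
  intro x hx
  obtain ⟨i, hi⟩ := Set.mem_iUnion.1 (hQ hx)
  exact Set.mem_iUnion.2 ⟨e i, by simpa using hi⟩

/-- Boundedness makes the set of admissible radii nonempty; otherwise `sInf` takes its default value
`0` and says nothing about covers. -/
theorem exists_cover_of_chi_lt [PseudoMetricSpace E] {Q : Set E} (hQ : Bornology.IsBounded Q)
    {ε : ℝ} (h : chi Q < ε) : ∃ (n : ℕ) (c : Fin n → E) (d : Fin n → ℝ),
      (∀ i, d i < ε) ∧ Q ⊆ ⋃ i, Metric.ball (c i) (d i) := by
  have hne : {ε : ℝ | 0 < ε ∧ ∃ (n : ℕ) (c : Fin n → E) (d : Fin n → ℝ),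
      (∀ i, d i < ε) ∧ Q ⊆ ⋃ i, Metric.ball (c i) (d i)}.Nonempty := by
    rcases Q.eq_empty_or_nonempty with rfl | ⟨x, -⟩
    · exact ⟨1, one_pos, 0, Fin.elim0, Fin.elim0, fun i => i.elim0, Set.empty_subset _⟩
    · obtain ⟨R, hR⟩ := hQ.subset_ball x
      refine ⟨|R| + 1, by positivity, 1, fun _ => x, fun _ => R, fun _ => ?_, ?_⟩
      · have := le_abs_self R
        linarith
      · exact hR.trans (Set.subset_iUnion (fun _ : Fin 1 => Metric.ball x R) 0)
  obtain ⟨δ, ⟨-, n, c, d, hd, hc⟩, hδ⟩ := exists_lt_of_csInf_lt hne h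
  exact ⟨n, c, d, fun i => (hd i).trans hδ, hc⟩

/-- A family of functionals that are `κ`-Lipschitz and tend to zero pointwise is eventually bounded
by `κ ε` on a set of measure of noncompactness less than `ε`. -/
theorem eventually_le_of_chi_lt [PseudoMetricSpace E] {Q : Set E} (hQ : Bornology.IsBounded Q)
    {ε κ : ℝ} (hκ : 0 < κ) (h : chi Q < ε) (p : ℕ → E → ℝ)
    (hp : ∀ n x c, p n x ≤ p n c + κ * dist x c)
    (hp0 : ∀ c, Tendsto (fun n => p n c) atTop (𝓝 0)) :
    ∀ᶠ n in atTop, ∀ x ∈ Q, p n x ≤ κ * ε := by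
  obtain ⟨m, c, d, hd, hc⟩ := exists_cover_of_chi_lt hQ h
  have h1 : ∀ᶠ n in atTop, ∀ i, p n (c i) < κ * (ε - d i) := by
    -- There are finitely many centres, so one threshold serves them all. The slack `ε - d i` is
    -- positive because the radii are strictly less than `ε`.
    rw [Filter.eventually_all]
    intro i
    exact (hp0 (c i)).eventually_lt_const (mul_pos hκ (sub_pos.2 (hd i)))
  filter_upwards [h1] with n hn x hx
  obtain ⟨i, hi⟩ := Set.mem_iUnion.1 (hc hx)
  have h2 : κ * dist x (c i) ≤ κ * d i := by
    gcongr
    exact (Metric.mem_ball.1 hi).le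
  linarith [hp n x (c i), hn i]

theorem chi_ball_le_one [SeminormedAddCommGroup E] : chi (Metric.ball (0 : E) 1) ≤ 1 := by
  refine le_of_forall_pos_le_add fun t ht => ?_
  exact chi_le_of_cover (ι := Unit) (by linarith) (fun _ => 0) (fun _ => 1) (fun _ => by linarith)
    (fun x hx => Set.mem_iUnion.2 ⟨(), hx⟩)

/-! ### Measures of noncompactness of continuous linear operators -/

variable [NormedAddCommGroup E] [NormedSpace ℂ E] [NormedAddCommGroup F] [NormedSpace ℂ F]

theorem isBounded_image (T : E →L[ℂ] F) {Q : Set E} (hQ : Bornology.IsBounded Q) :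
    Bornology.IsBounded (T '' Q) :=
  T.lipschitz.isBounded_image hQ

/-- Each ball of a cover of `Q` lies in a translated dilate of the unit ball, and `T` carries it
into the same dilate of the image of the unit ball, which has its own finite cover. The slack `t`
makes both infima approachable and keeps the dilation factor nonzero. -/
theorem chi_image_le_mul (T : E →L[ℂ] F) {Q : Set E} (hQ : Bornology.IsBounded Q) :
    chi (T '' Q) ≤ chi (T '' Metric.ball 0 1) * chi Q := by
  have key : ∀ t : ℝ, 0 < t →
      chi (T '' Q) ≤ (chi (T '' Metric.ball 0 1) + t) * (chi Q + t) := by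
    intro t ht
    set a := chi (T '' Metric.ball 0 1) + t with ha
    set b := chi Q + t with hb
    have ha0 : 0 < a := add_pos_of_nonneg_of_pos (chi_nonneg _) ht
    have hb0 : 0 < b := add_pos_of_nonneg_of_pos (chi_nonneg _) ht
    obtain ⟨n, c, d, hd, hc⟩ := exists_cover_of_chi_lt hQ (ε := b) (by linarith)
    obtain ⟨m, u, v, hv, hu⟩ := exists_cover_of_chi_lt
      (isBounded_image T (Metric.isBounded_ball (x := (0 : E)) (r := 1))) (ε := a) (by linarith)
    refine chi_le_of_cover (ι := Fin n × Fin m) (mul_pos ha0 hb0)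
      (fun i => T (c i.1) + (b : ℂ) • u i.2) (fun i => v i.2 * b)
      (fun i => mul_lt_mul_of_pos_right (hv _) hb0) ?_
    rintro _ ⟨x, hx, rfl⟩
    obtain ⟨i, hi⟩ := Set.mem_iUnion.1 (hc hx)
    have hbC : (b : ℂ) ≠ 0 := by exact_mod_cast hb0.ne'
    have hy : (b : ℂ)⁻¹ • (x - c i) ∈ Metric.ball (0 : E) 1 := by
      rw [mem_ball_zero_iff, norm_smul, norm_inv, Complex.norm_real, Real.norm_of_nonneg hb0.le,
        inv_mul_lt_one₀ hb0, ← dist_eq_norm]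
      exact (Metric.mem_ball.1 hi).trans (hd i)
    obtain ⟨j, hj⟩ := Set.mem_iUnion.1 (hu ⟨_, hy, rfl⟩)
    refine Set.mem_iUnion.2 ⟨(i, j), ?_⟩
    rw [Metric.mem_ball, dist_eq_norm] at hj ⊢
    have e : T x - (T (c i) + (b : ℂ) • u j) =
        (b : ℂ) • (T ((b : ℂ)⁻¹ • (x - c i)) - u j) := by
      rw [smul_sub, map_smul, smul_inv_smul₀ hbC, map_sub]
      abel
    rw [e, norm_smul, Complex.norm_real, Real.norm_of_nonneg hb0.le, mul_comm]
    exact mul_lt_mul_of_pos_right hj hb0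
  have hlim : Tendsto (fun t : ℝ => (chi (T '' Metric.ball 0 1) + t) * (chi Q + t)) (𝓝[>] 0)
      (𝓝 ((chi (T '' Metric.ball 0 1) + 0) * (chi Q + 0))) :=
    (Continuous.tendsto (by fun_prop) 0).mono_left nhdsWithin_le_nhds
  rw [add_zero, add_zero] at hlim
  exact ge_of_tendsto hlim (eventually_mem_nhdsWithin.mono key)

theorem chiBounded_clm (T : E →L[ℂ] F) : ChiBounded T := by
  -- The added `1` makes the constant positive even when the operator is compact.
  refine ⟨fun Q hQ => isBounded_image T hQ, chi (T '' Metric.ball 0 1) + 1,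
    add_pos_of_nonneg_of_pos (chi_nonneg _) one_pos, fun Q hQ => ?_⟩
  have := chi_image_le_mul T hQ
  have := chi_nonneg Q
  linarith

/-- One bound is `chi_image_le_mul`; the other tests an admissible constant on the unit ball, whose
own measure is at most `1`. -/
theorem chiNorm_clm (T : E →L[ℂ] F) : chiNorm T = chi (T '' Metric.ball 0 1) := by
  refine le_antisymm (csInf_le ⟨0, fun _ h => h.1⟩
    ⟨chi_nonneg _, fun Q hQ => chi_image_le_mul T hQ⟩) ?_
  refine le_csInf ⟨_, chi_nonneg _, fun Q hQ => chi_image_le_mul T hQ⟩ fun C hC => ?_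
  refine (hC.2 _ Metric.isBounded_ball).trans ?_
  exact mul_le_of_le_one_right hC.1 chi_ball_le_one

/-- An operator within `t` of a finite-rank operator on the unit ball has measure of noncompactness
at most `t`. -/
theorem chi_le_of_finite_rank (T : E →L[ℂ] F) {ι : Type*} [Fintype ι] (φ : ι → E →L[ℂ] ℂ)
    (b : ι → F) {t : ℝ} (ht : 0 ≤ t)
    (h : ∀ x ∈ Metric.ball (0 : E) 1, ‖T x - ∑ i, φ i x • b i‖ ≤ t) :
    chi (T '' Metric.ball 0 1) ≤ t := by
  set G : (ι → ℂ) →L[ℂ] F := LinearMap.toContinuousLinearMap (Fintype.linearCombination ℂ b)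
    with hG
  have hGa : ∀ v, G v = ∑ i, v i • b i := fun v => Fintype.linearCombination_apply ℂ b v
  set Φ : E →L[ℂ] (ι → ℂ) := ContinuousLinearMap.pi φ with hΦ
  -- The approximating operator factors through `ι → ℂ`, so the image of the unit ball under it lies
  -- in a compact set. A finite net of that set also serves for `T`, with radii enlarged by `t`.
  have htb : TotallyBounded (G '' Metric.closedBall 0 ‖Φ‖) :=
    ((isCompact_closedBall (0 : ι → ℂ) ‖Φ‖).image G.continuous).totallyBounded
  refine le_of_forall_pos_le_add fun ε hε => ?_
  obtain ⟨s, hs, hcov⟩ := Metric.totallyBounded_iff.1 htb (ε / 3) (by positivity)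
  have := hs.to_subtype
  refine chi_le_of_cover (ι := s) (by linarith) (fun y => (y : F)) (fun _ => t + ε / 2)
    (fun _ => by linarith) ?_
  rintro _ ⟨x, hx, rfl⟩
  have hx1 : ‖Φ x‖ ≤ ‖Φ‖ := Φ.unit_le_opNorm x (mem_ball_zero_iff.1 hx).le
  obtain ⟨y, hy, hxy⟩ := Set.mem_iUnion₂.1
    (hcov ⟨Φ x, by simpa using hx1, rfl⟩)
  refine Set.mem_iUnion.2 ⟨⟨y, hy⟩, ?_⟩
  rw [Metric.mem_ball] at hxy ⊢
  have h1 : dist (T x) (G (Φ x)) ≤ t := by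
    rw [dist_eq_norm, hGa]
    exact h x hx
  have := dist_triangle (T x) (G (Φ x)) y
  simp only
  linarith

theorem opNorm_le_of_unit_ball (T : E →L[ℂ] F) {C : ℝ}
    (h : ∀ x ∈ Metric.ball (0 : E) 1, ‖T x‖ ≤ C) : ‖T‖ ≤ C := by
  rw [← T.sSup_unit_ball_eq_norm]
  refine csSup_le ⟨_, 0, by simp, rfl⟩ ?_
  rintro _ ⟨x, hx, rfl⟩
  exact h x hx

end Chi

/-! ### Completeness of the sequence spaces -/

theorem isClosed_null : IsClosed (null : Set (LP ∞)) := by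
  refine isClosed_of_closure_subset fun x hx => ?_
  change Tendsto (fun n => x n) atTop (𝓝 0)
  rw [Metric.tendsto_atTop]
  intro ε hε
  obtain ⟨y, hy, hxy⟩ := Metric.mem_closure_iff.1 hx (ε / 2) (by positivity)
  obtain ⟨N, hN⟩ := Metric.tendsto_atTop.1 (show Tendsto (fun n => y n) atTop (𝓝 0) from hy)
    (ε / 2) (by positivity)
  refine ⟨N, fun n hn => ?_⟩
  have h1 : dist (x n) (y n) ≤ dist x y := by
    rw [dist_eq_norm, dist_eq_norm]
    exact lp.norm_apply_le_norm ENNReal.top_ne_zero (x - y) n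
  linarith [dist_triangle (x n) (y n) 0, hN n hn]

theorem isClosed_conv : IsClosed (conv : Set (LP ∞)) := by
  refine isClosed_of_closure_subset fun x hx => ?_
  change ∃ l, Tendsto (fun n => x n) atTop (𝓝 l)
  refine cauchySeq_tendsto_of_complete (Metric.cauchySeq_iff.2 fun ε hε => ?_)
  obtain ⟨y, ⟨l, hl⟩, hxy⟩ := Metric.mem_closure_iff.1 hx (ε / 3) (by positivity)
  obtain ⟨N, hN⟩ := Metric.cauchySeq_iff.1 hl.cauchySeq (ε / 3) (by positivity)
  refine ⟨N, fun m hm n hn => ?_⟩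
  have h1 : ∀ k, dist (x k) (y k) ≤ dist x y := by
    intro k
    rw [dist_eq_norm, dist_eq_norm]
    exact lp.norm_apply_le_norm ENNReal.top_ne_zero (x - y) k
  have h2 := h1 n
  rw [dist_comm] at h2
  linarith [dist_triangle4 (x m) (y m) (y n) (x n), hN m hm n hn, h1 m]

instance : CompleteSpace null := isClosed_null.completeSpace_coe

instance : CompleteSpace conv := isClosed_conv.completeSpace_coe

instance (p : ℝ≥0∞) [Fact (1 ≤ p)] : CompleteSpace (⊤ : Submodule ℂ (LP p)) :=
  isClosed_univ.completeSpace_coe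

theorem single_mem_null (k : ℕ) (a : ℂ) : lp.single ∞ k a ∈ null := by
  refine tendsto_const_nhds.congr' ?_
  filter_upwards [eventually_gt_atTop k] with n hn
  exact (lp.single_apply_ne (E := fun _ : ℕ => ℂ) ∞ k a hn.ne').symm

theorem null_le_conv : null ≤ conv := fun _ h => ⟨0, h⟩

/-- The limit, as a functional on `c`. -/
def limCLM : conv →L[ℂ] ℂ :=
  LinearMap.mkContinuous
    { toFun := fun x => Classical.choose x.2
      map_add' := fun x y => tendsto_nhds_unique (Classical.choose_spec (x + y).2)
        ((Classical.choose_spec x.2).add (Classical.choose_spec y.2))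
      map_smul' := fun a x => tendsto_nhds_unique (Classical.choose_spec (a • x).2)
        ((Classical.choose_spec x.2).const_mul a) } 1 (by
    intro x
    rw [one_mul]
    exact le_of_tendsto (Classical.choose_spec x.2).norm
      (Eventually.of_forall fun n => lp.norm_apply_le_norm ENNReal.top_ne_zero (x : LP ∞) n))

theorem tendsto_limCLM (x : conv) : Tendsto (fun n => (x : LP ∞) n) atTop (𝓝 (limCLM x)) :=
  Classical.choose_spec x.2

theorem norm_limCLM_le (x : conv) : ‖limCLM x‖ ≤ ‖x‖ :=
  le_of_tendsto (tendsto_limCLM x).norm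
    (Eventually.of_forall fun n => lp.norm_apply_le_norm ENNReal.top_ne_zero (x : LP ∞) n)

/-! ### Operators given by their coordinate functionals -/

theorem norm_coord_le {p : ℝ≥0∞} [Fact (1 ≤ p)] {Y : Submodule ℂ (LP p)} (y : Y) (n : ℕ) :
    ‖(y : LP p) n‖ ≤ ‖y‖ :=
  lp.norm_apply_le_norm (zero_lt_one.trans_le Fact.out).ne' (y : LP p) n

theorem norm_le_of_coord_le {Y : Submodule ℂ (LP ∞)} (y : Y) {C : ℝ} (hC : 0 ≤ C)
    (h : ∀ n, ‖(y : LP ∞) n‖ ≤ C) : ‖y‖ ≤ C :=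
  lp.norm_le_of_forall_le hC h

theorem norm_le_of_sum_coord_le {Y : Submodule ℂ (LP 1)} (y : Y) {C : ℝ} (hC : 0 ≤ C)
    (h : ∀ s : Finset ℕ, ∑ n ∈ s, ‖(y : LP 1) n‖ ≤ C) : ‖y‖ ≤ C :=
  lp.norm_le_of_forall_sum_le (f := (y : LP 1)) (by simp) hC (by simpa using h)

section Coordinates

variable {E : Type*} [NormedAddCommGroup E] [NormedSpace ℂ E]

/-- A map into a complete sequence space with continuous linear coordinates is continuous and
linear. -/
theorem exists_clm_of_coord [CompleteSpace E] {p : ℝ≥0∞} [Fact (1 ≤ p)] {Y : Submodule ℂ (LP p)}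
    [CompleteSpace Y] (L : E → Y) (φ : ℕ → E →L[ℂ] ℂ) (hL : ∀ x n, (L x : LP p) n = φ n x) :
    ∃ T : E →L[ℂ] Y, ⇑T = L := by
  let M : E →ₗ[ℂ] Y :=
    { toFun := L
      map_add' := fun x y => by
        refine Subtype.ext (lp.ext (funext fun n => ?_))
        rw [Submodule.coe_add, lp.coeFn_add, Pi.add_apply, hL, hL, hL, map_add]
      map_smul' := fun a x => by
        refine Subtype.ext (lp.ext (funext fun n => ?_))
        rw [RingHom.id_apply, Submodule.coe_smul, lp.coeFn_smul, Pi.smul_apply, hL, hL, map_smul] }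
  -- The graph is closed because convergence in `Y` forces coordinatewise convergence, and the
  -- coordinates of the limit are fixed by continuity of each `φ n`.
  have hM : ∀ (u : ℕ → E) (x y), Tendsto u atTop (𝓝 x) → Tendsto (M ∘ u) atTop (𝓝 y) →
      y = M x := by
    intro u x y hu hy
    refine Subtype.ext (lp.ext (funext fun n => ?_))
    have h1 : Tendsto (fun i => ((M (u i) : Y) : LP p) n) atTop (𝓝 ((y : LP p) n)) := by
      rw [tendsto_iff_norm_sub_tendsto_zero] at hy ⊢
      refine squeeze_zero (fun _ => norm_nonneg _) (fun i => ?_) hy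
      exact norm_coord_le (M (u i) - y) n
    have h2 : Tendsto (fun i => ((M (u i) : Y) : LP p) n) atTop (𝓝 (φ n x)) := by
      have : (fun i => ((M (u i) : Y) : LP p) n) = fun i => φ n (u i) := funext fun i => hL _ _
      rw [this]
      exact ((φ n).continuous.tendsto x).comp hu
    exact (tendsto_nhds_unique h1 h2).trans (hL x n).symm
  exact ⟨ContinuousLinearMap.ofSeqClosedGraph (g := M) hM, rfl⟩

theorem enorm_coord_le {p : ℝ≥0∞} [Fact (1 ≤ p)] {Y : Submodule ℂ (LP p)} (T : E →L[ℂ] Y)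
    (φ : ℕ → E →L[ℂ] ℂ) (hT : ∀ x n, (T x : LP p) n = φ n x) (n : ℕ) : ‖φ n‖ₑ ≤ ‖T‖ₑ := by
  rw [enorm_le_iff_norm_le]
  refine (φ n).opNorm_le_bound (norm_nonneg _) fun x => ?_
  rw [← hT]
  exact (norm_coord_le _ n).trans (T.le_opNorm x)

theorem sum_smul_single_apply {p : ℝ≥0∞} {Y : Submodule ℂ (LP p)}
    (hY : ∀ k, lp.single p k (1 : ℂ) ∈ Y) (a : ℕ → ℂ) (r n : ℕ) :
    ((∑ i : Fin r, a i • (⟨lp.single p (i : ℕ) 1, hY i⟩ : Y) : Y) : LP p) n =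
      if n < r then a n else 0 := by
  rw [Fin.sum_univ_eq_sum_range (fun i => a i • (⟨lp.single p i 1, hY i⟩ : Y)) r,
    Submodule.coe_sum, lp.coeFn_sum, Finset.sum_apply]
  have : ∀ k, ((a k • (⟨lp.single p k 1, hY k⟩ : Y) : Y) : LP p) n = if n = k then a k else 0 := by
    intro k
    rw [Submodule.coe_smul, lp.coeFn_smul, Pi.smul_apply, lp.single_apply]
    by_cases h : n = k
    · subst h; simp
    · simp [h]
  rw [Finset.sum_congr rfl fun k _ => this k]
  simp

/-- An antitone sequence of extended reals starting at a finite value has a finite limit. -/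
theorem exists_tendsto_of_antitone {S : ℕ → ℝ≥0∞} (hS : Antitone S) (h0 : S 0 ≠ ∞) :
    ∃ l : ℝ≥0, Tendsto S atTop (𝓝 (l : ℝ≥0∞)) ∧ ∀ r, (l : ℝ≥0∞) ≤ S r := by
  have hfin : (⨅ r, S r) ≠ ∞ := ((iInf_le S 0).trans_lt h0.lt_top).ne
  refine ⟨(⨅ r, S r).toNNReal, ?_, fun r => ?_⟩
  · rw [ENNReal.coe_toNNReal hfin]
    exact tendsto_atTop_iInf hS
  · rw [ENNReal.coe_toNNReal hfin]
    exact iInf_le S r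

/-! ### Limits of tail suprema, and the targets `ℓ_∞`, `c_0`, `c` -/

theorem antitone_iSup_ge (u : ℕ → ℝ≥0∞) : Antitone fun r => ⨆ n ≥ r, u n :=
  fun _ _ h => iSup_mono fun _ => iSup_mono' fun hn => ⟨h.trans hn, le_rfl⟩

theorem le_coe_of_tendsto {S : ℕ → ℝ≥0∞} {l : ℝ≥0} (hS : Tendsto S atTop (𝓝 (l : ℝ≥0∞))) {x : ℝ}
    (h : ∀ r, ENNReal.ofReal x ≤ S r) : x ≤ l := by
  have := ge_of_tendsto' hS h
  rwa [ENNReal.ofReal_le_iff_le_toReal ENNReal.coe_ne_top, ENNReal.coe_toReal] at this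

/-- Common end of the lower bounds: the index `r` may depend on `ε` because `l` lies below every `S
r`. Then `ε` decreases to `x`. -/
theorem coe_le_mul_of_forall_lt {S : ℕ → ℝ≥0∞} {l : ℝ≥0} (hS : ∀ r, (l : ℝ≥0∞) ≤ S r) {κ x : ℝ}
    (hκ : 0 < κ) (hx : 0 ≤ x) (h : ∀ ε, x < ε → ∃ r, S r ≤ ENNReal.ofReal (κ * ε)) :
    (l : ℝ) ≤ κ * x := by
  rw [← div_le_iff₀' hκ]
  refine le_of_forall_gt_imp_ge_of_dense fun ε hε => ?_
  obtain ⟨r, hr⟩ := h ε hε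
  rw [div_le_iff₀' hκ]
  have h1 := (hS r).trans hr
  have h2 : 0 ≤ κ * ε := mul_nonneg hκ.le (hx.trans hε.le)
  rwa [ENNReal.le_ofReal_iff_toReal_le ENNReal.coe_ne_top h2, ENNReal.coe_toReal] at h1

/-- Removing the first `r` coordinates is a finite-rank perturbation, and what is left is bounded on
the unit ball by the supremum of the remaining `‖φ n‖`. -/
theorem ofReal_chi_le_iSup {Y : Submodule ℂ (LP ∞)} (hY : ∀ k, lp.single ∞ k (1 : ℂ) ∈ Y)
    (T : E →L[ℂ] Y) (φ : ℕ → E →L[ℂ] ℂ) (hT : ∀ x n, (T x : LP ∞) n = φ n x) (r : ℕ) :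
    ENNReal.ofReal (chi (T '' Metric.ball 0 1)) ≤ ⨆ n ≥ r, ‖φ n‖ₑ := by
  have hfin : (⨆ n ≥ r, ‖φ n‖ₑ) ≠ ∞ :=
    ((iSup₂_le fun n _ => enorm_coord_le T φ hT n).trans_lt enorm_lt_top).ne
  rw [ENNReal.ofReal_le_iff_le_toReal hfin]
  refine chi_le_of_finite_rank T (fun i : Fin r => φ i) (fun i => ⟨lp.single ∞ (i : ℕ) 1, hY i⟩)
    ENNReal.toReal_nonneg fun x hx => ?_
  refine norm_le_of_coord_le _ ENNReal.toReal_nonneg fun n => ?_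
  rw [Submodule.coe_sub, lp.coeFn_sub, Pi.sub_apply,
    sum_smul_single_apply hY (fun i => φ i x) r n, hT]
  split_ifs with h
  · simp
  · rw [sub_zero]
    refine ((φ n).unit_le_opNorm x (mem_ball_zero_iff.1 hx).le).trans ?_
    rw [← toReal_enorm]
    exact ENNReal.toReal_mono hfin (le_iSup₂_of_le n (not_lt.1 h) le_rfl)

theorem chiNorm_into_linf [CompleteSpace E] (L : E → linf) (φ : ℕ → E →L[ℂ] ℂ)
    (hL : ∀ x n, (L x : LP ∞) n = φ n x) :
    ChiBounded L ∧ ∃ l : ℝ≥0, Tendsto (fun r : ℕ => ⨆ n ≥ r, ‖φ n‖ₑ) atTop (𝓝 (l : ℝ≥0∞)) ∧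
      0 ≤ chiNorm L ∧ chiNorm L ≤ l := by
  obtain ⟨T, rfl⟩ := exists_clm_of_coord L φ hL
  obtain ⟨l, hl, -⟩ := exists_tendsto_of_antitone (antitone_iSup_ge fun n => ‖φ n‖ₑ)
    ((iSup₂_le fun n _ => enorm_coord_le T φ hL n).trans_lt enorm_lt_top).ne
  refine ⟨chiBounded_clm T, l, hl, ?_⟩
  rw [chiNorm_clm]
  exact ⟨chi_nonneg _,
    le_coe_of_tendsto hl (ofReal_chi_le_iSup (fun _ => Submodule.mem_top) T φ hL)⟩

/-- Equality holds because the maps `y ↦ |y_n|` are `1`-Lipschitz and tend to zero pointwise on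
`c_0`, so `eventually_le_of_chi_lt` applies without loss. -/
theorem chiNorm_into_null [CompleteSpace E] (L : E → null) (φ : ℕ → E →L[ℂ] ℂ)
    (hL : ∀ x n, (L x : LP ∞) n = φ n x) :
    ChiBounded L ∧ ∃ l : ℝ≥0, Tendsto (fun r : ℕ => ⨆ n ≥ r, ‖φ n‖ₑ) atTop (𝓝 (l : ℝ≥0∞)) ∧
      chiNorm L = l := by
  obtain ⟨T, rfl⟩ := exists_clm_of_coord L φ hL
  obtain ⟨l, hl, hle⟩ := exists_tendsto_of_antitone (antitone_iSup_ge fun n => ‖φ n‖ₑ)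
    ((iSup₂_le fun n _ => enorm_coord_le T φ hL n).trans_lt enorm_lt_top).ne
  refine ⟨chiBounded_clm T, l, hl, ?_⟩
  rw [chiNorm_clm]
  refine le_antisymm
    (le_coe_of_tendsto hl (ofReal_chi_le_iSup (fun k => single_mem_null k 1) T φ hL)) ?_
  rw [← one_mul (chi _)]
  refine coe_le_mul_of_forall_lt hle one_pos (chi_nonneg _) fun ε hε => ?_
  have hev := eventually_le_of_chi_lt (isBounded_image T Metric.isBounded_ball) one_pos hε
    (fun n y => ‖(y : LP ∞) n‖)
    (fun n x c => by
      rw [one_mul, dist_eq_norm]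
      have h1 := norm_coord_le (x - c) n
      have h2 : ((x - c : null) : LP ∞) n = (x : LP ∞) n - (c : LP ∞) n := rfl
      rw [h2] at h1
      linarith [norm_le_norm_add_norm_sub ((c : LP ∞) n) ((x : LP ∞) n),
        norm_sub_rev ((x : LP ∞) n) ((c : LP ∞) n)])
    (fun c => by simpa using (show Tendsto (fun n => (c : LP ∞) n) atTop (𝓝 0) from c.2).norm)
  obtain ⟨r, hr⟩ := eventually_atTop.1 hev
  refine ⟨r, iSup₂_le fun n hn => ?_⟩
  rw [← ofReal_norm]
  refine ENNReal.ofReal_le_ofReal (opNorm_le_of_unit_ball _ fun x hx => ?_)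
  rw [← hL]
  exact hr n hn _ ⟨x, hx, rfl⟩

/-- The indicator sequence of `{n | r ≤ n}`. -/
def tailOne (r : ℕ) : conv :=
  ⟨1 - ∑ k ∈ Finset.range r, lp.single ∞ k 1, conv.sub_mem
    ⟨1, by simp [lp.infty_coeFn_one]⟩
    (conv.sum_mem fun k _ => null_le_conv (single_mem_null k 1))⟩

theorem tailOne_apply (r n : ℕ) : (tailOne r : LP ∞) n = if n < r then 0 else 1 := by
  simp only [tailOne]
  rw [lp.coeFn_sub, Pi.sub_apply, lp.infty_coeFn_one, lp.coeFn_sum, Finset.sum_apply]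
  have : ∀ k, (lp.single ∞ k 1 : LP ∞) n = if n = k then 1 else 0 := by
    intro k
    rw [lp.single_apply]
    by_cases h : n = k
    · subst h; simp
    · simp [h]
  simp only [this, Finset.sum_ite_eq, Finset.mem_range, Pi.one_apply]
  split_ifs <;> simp

theorem chiNorm_into_conv [CompleteSpace E] (L : E → conv) (φ : ℕ → E →L[ℂ] ℂ)
    (hL : ∀ x n, (L x : LP ∞) n = φ n x) (ψ : E →L[ℂ] ℂ)
    (hψ : ∀ x, Tendsto (fun n => φ n x) atTop (𝓝 (ψ x))) :
    ChiBounded L ∧ ∃ l : ℝ≥0, Tendsto (fun r : ℕ => ⨆ n ≥ r, ‖φ n - ψ‖ₑ) atTop (𝓝 (l : ℝ≥0∞)) ∧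
      (1 / 2 : ℝ) * l ≤ chiNorm L ∧ chiNorm L ≤ l := by
  obtain ⟨T, rfl⟩ := exists_clm_of_coord L φ hL
  have hψT : ∀ x, ψ x = limCLM (T x) := fun x =>
    tendsto_nhds_unique (hψ x) ((tendsto_limCLM (T x)).congr fun n => hL x n)
  have hψn : ‖ψ‖ₑ ≤ ‖T‖ₑ := by
    rw [enorm_le_iff_norm_le]
    refine ψ.opNorm_le_bound (norm_nonneg _) fun x => ?_
    rw [hψT]
    exact (norm_limCLM_le _).trans (T.le_opNorm x)
  have hfin : ∀ r, (⨆ n ≥ r, ‖φ n - ψ‖ₑ) ≠ ∞ := fun r => ((iSup₂_le fun n _ =>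
    enorm_sub_le.trans (add_le_add (enorm_coord_le T φ hL n) hψn)).trans_lt
      (ENNReal.add_lt_top.2 ⟨enorm_lt_top, enorm_lt_top⟩)).ne
  obtain ⟨l, hl, hle⟩ := exists_tendsto_of_antitone (antitone_iSup_ge fun n => ‖φ n - ψ‖ₑ) (hfin 0)
  refine ⟨chiBounded_clm T, l, hl, ?_⟩
  rw [chiNorm_clm]
  constructor
  -- The factor `1/2` arises because `y ↦ |y_n - lim y|` is only `2`-Lipschitz: a coordinate and the
  -- limit can move in opposite directions.
  · suffices (l : ℝ) ≤ 2 * chi (T '' Metric.ball 0 1) by linarith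
    refine coe_le_mul_of_forall_lt hle two_pos (chi_nonneg _) fun ε hε => ?_
    have hev := eventually_le_of_chi_lt (isBounded_image T Metric.isBounded_ball) two_pos hε
      (fun n y => ‖(y : LP ∞) n - limCLM y‖)
      (fun n x c => by
        have h1 := norm_coord_le (x - c) n
        have h2 : ((x - c : conv) : LP ∞) n = (x : LP ∞) n - (c : LP ∞) n := rfl
        have h3 := norm_limCLM_le (x - c)
        rw [ContinuousLinearMap.map_sub limCLM x c] at h3
        rw [h2] at h1
        have e : (x : LP ∞) n - limCLM x = ((c : LP ∞) n - limCLM c) +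
          (((x : LP ∞) n - (c : LP ∞) n) - (limCLM x - limCLM c)) := by ring
        rw [e, dist_eq_norm]
        have h4 := norm_add_le ((c : LP ∞) n - limCLM c)
          (((x : LP ∞) n - (c : LP ∞) n) - (limCLM x - limCLM c))
        have h5 := norm_sub_le ((x : LP ∞) n - (c : LP ∞) n) (limCLM x - limCLM c)
        linarith)
      (fun c => tendsto_iff_norm_sub_tendsto_zero.1 (tendsto_limCLM c))
    obtain ⟨r, hr⟩ := eventually_atTop.1 hev
    refine ⟨r, iSup₂_le fun n hn => ?_⟩
    rw [← ofReal_norm]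
    refine ENNReal.ofReal_le_ofReal (opNorm_le_of_unit_ball _ fun x hx => ?_)
    rw [sub_apply, ← hL, hψT]
    exact hr n hn _ ⟨x, hx, rfl⟩
  · refine le_coe_of_tendsto hl fun r => ?_
    rw [ENNReal.ofReal_le_iff_le_toReal (hfin r)]
    have hY : ∀ k, lp.single ∞ k (1 : ℂ) ∈ conv := fun k => null_le_conv (single_mem_null k 1)
    -- The finite-rank operator keeps the first `r` coordinates and replaces all later ones by the
    -- limit `ψ x`; the extra index `none` carries the constant tail.
    refine chi_le_of_finite_rank T (ι := Option (Fin r)) (fun i => i.elim ψ fun i => φ i)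
      (fun i => i.elim (tailOne r) fun i => ⟨lp.single ∞ (i : ℕ) 1, hY i⟩)
      ENNReal.toReal_nonneg fun x hx => ?_
    refine norm_le_of_coord_le _ ENNReal.toReal_nonneg fun n => ?_
    rw [Fintype.sum_option]
    simp only [Option.elim]
    rw [Submodule.coe_sub, lp.coeFn_sub, Pi.sub_apply, Submodule.coe_add, lp.coeFn_add,
      Pi.add_apply, sum_smul_single_apply hY (fun i => φ i x) r n, hL, Submodule.coe_smul,
      lp.coeFn_smul, Pi.smul_apply, tailOne_apply]
    split_ifs with h
    · simp
    · rw [add_zero, smul_eq_mul, mul_one, ← sub_apply]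
      refine ((φ n - ψ).unit_le_opNorm x (mem_ball_zero_iff.1 hx).le).trans ?_
      rw [← toReal_enorm]
      exact ENNReal.toReal_mono (hfin r) (le_iSup₂_of_le n (not_lt.1 h) le_rfl)

/-! ### Operators into `ℓ_1` -/

theorem sum_abs_le_two_mul {ι : Type*} (s : Finset ι) (u : ι → ℝ) {M : ℝ}
    (h : ∀ t ⊆ s, |∑ i ∈ t, u i| ≤ M) : ∑ i ∈ s, |u i| ≤ 2 * M := by
  rw [← Finset.sum_filter_add_sum_filter_not s (fun i => 0 ≤ u i)]
  have h1 : ∑ i ∈ s with 0 ≤ u i, |u i| = ∑ i ∈ s with 0 ≤ u i, u i :=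
    Finset.sum_congr rfl fun i hi => abs_of_nonneg (Finset.mem_filter.1 hi).2
  have h2 : ∑ i ∈ s with ¬0 ≤ u i, |u i| = -∑ i ∈ s with ¬0 ≤ u i, u i := by
    rw [← Finset.sum_neg_distrib]
    exact Finset.sum_congr rfl fun i hi => abs_of_neg (not_le.1 (Finset.mem_filter.1 hi).2)
  rw [h1, h2]
  have h3 := (le_abs_self _).trans (h _ (Finset.filter_subset (fun i => 0 ≤ u i) s))
  have h4 := (neg_le_abs _).trans (h _ (Finset.filter_subset (fun i => ¬0 ≤ u i) s))
  linarith

/-- Source of the constant `4` for `ℓ_1`: real and imaginary parts are each split by sign, which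
gives four subsums, each at most `M`. -/
theorem sum_norm_le_four_mul {ι : Type*} (s : Finset ι) (z : ι → ℂ) {M : ℝ}
    (h : ∀ t ⊆ s, ‖∑ i ∈ t, z i‖ ≤ M) : ∑ i ∈ s, ‖z i‖ ≤ 4 * M := by
  have h1 := sum_abs_le_two_mul s (fun i => (z i).re) (M := M) fun t ht => by
    rw [← Complex.re_sum]
    exact (Complex.abs_re_le_norm _).trans (h t ht)
  have h2 := sum_abs_le_two_mul s (fun i => (z i).im) (M := M) fun t ht => by
    rw [← Complex.im_sum]
    exact (Complex.abs_im_le_norm _).trans (h t ht)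
  calc ∑ i ∈ s, ‖z i‖ ≤ ∑ i ∈ s, (|(z i).re| + |(z i).im|) :=
        Finset.sum_le_sum fun i _ => Complex.norm_le_abs_re_add_abs_im _
    _ ≤ 4 * M := by
        rw [Finset.sum_add_distrib]
        linarith

theorem hasSum_norm_lp_one (x : LP 1) : HasSum (fun n => ‖x n‖) ‖x‖ := by
  simpa using lp.hasSum_norm (p := 1) (by simp) x

theorem cut_apply_clm (φ : ℕ → E →L[ℂ] ℂ) (r n : ℕ) (x : E) :
    cut φ r n x = cut (fun n => φ n x) r n := by
  unfold cut
  split_ifs <;> rfl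

theorem norm_cut_le {G : Type*} [SeminormedAddCommGroup G] (u : ℕ → G) (r n : ℕ) :
    ‖cut u r n‖ ≤ ‖u n‖ := by
  unfold cut
  split_ifs <;> simp

theorem sum_cut_cut {G : Type*} [AddCommMonoid G] (u : ℕ → G) {r r' : ℕ} (h : r ≤ r')
    (N : Finset ℕ) : ∑ n ∈ N, cut u r' n = ∑ n ∈ N.filter (r' < ·), cut u r n := by
  rw [Finset.sum_filter]
  refine Finset.sum_congr rfl fun n _ => ?_
  unfold cut
  split_ifs <;> first | rfl | omega

theorem antitone_iSup_cut (φ : ℕ → E →L[ℂ] ℂ) :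
    Antitone fun r => ⨆ N : Finset ℕ, ‖∑ n ∈ N, cut φ r n‖ₑ := by
  intro r r' h
  refine iSup_le fun N => ?_
  rw [sum_cut_cut φ h]
  exact le_iSup (fun N : Finset ℕ => ‖∑ n ∈ N, cut φ r n‖ₑ) _

/-- The lower bound uses the tail norms `∑_{n > r} |y_n|`, which dominate every finite subsum.
Conversely `sum_norm_le_four_mul` recovers a tail norm from the subsums, at the cost of a factor
`4`. -/
theorem chiNorm_into_l1 [CompleteSpace E] (L : E → l1) (φ : ℕ → E →L[ℂ] ℂ)
    (hL : ∀ x n, (L x : LP 1) n = φ n x) :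
    ChiBounded L ∧ ∃ l : ℝ≥0,
      Tendsto (fun r : ℕ => ⨆ N : Finset ℕ, ‖∑ n ∈ N, cut φ r n‖ₑ) atTop (𝓝 (l : ℝ≥0∞)) ∧
      (l : ℝ) ≤ chiNorm L ∧ chiNorm L ≤ 4 * l := by
  obtain ⟨T, rfl⟩ := exists_clm_of_coord L φ hL
  have hsum : ∀ (x : E) (r : ℕ), Summable fun n => ‖cut (fun n => φ n x) r n‖ := fun x r =>
    Summable.of_nonneg_of_le (fun _ => norm_nonneg _) (fun n => norm_cut_le _ r n)
      ((hasSum_norm_lp_one (T x : LP 1)).summable.congr fun n => by rw [hL])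
  have hfin : ∀ r, (⨆ N : Finset ℕ, ‖∑ n ∈ N, cut φ r n‖ₑ) ≠ ∞ := by
    intro r
    refine ((iSup_le fun N => ?_).trans_lt (enorm_lt_top (x := T))).ne
    rw [enorm_le_iff_norm_le]
    refine ContinuousLinearMap.opNorm_le_bound _ (norm_nonneg _) fun x => ?_
    refine le_trans ?_ (T.le_opNorm x)
    rw [sum_apply]
    refine (norm_sum_le _ _).trans ?_
    refine le_trans ?_ (sum_le_hasSum N (fun _ _ => norm_nonneg _)
      (hasSum_norm_lp_one (T x : LP 1)))
    refine Finset.sum_le_sum fun n _ => ?_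
    rw [cut_apply_clm, hL]
    exact norm_cut_le (fun n => φ n x) r n
  obtain ⟨l, hl, hle⟩ := exists_tendsto_of_antitone (antitone_iSup_cut φ) (hfin 0)
  refine ⟨chiBounded_clm T, l, hl, ?_⟩
  rw [chiNorm_clm]
  constructor
  · rw [← one_mul (chi _)]
    refine coe_le_mul_of_forall_lt hle one_pos (chi_nonneg _) fun ε hε => ?_
    have hs : ∀ (y : l1) (r : ℕ), Summable fun n => ‖cut (fun n => (y : LP 1) n) r n‖ := fun y r =>
      Summable.of_nonneg_of_le (fun _ => norm_nonneg _) (fun n => norm_cut_le _ r n)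
        (hasSum_norm_lp_one (y : LP 1)).summable
    have hev := eventually_le_of_chi_lt (isBounded_image T Metric.isBounded_ball) one_pos hε
      (fun r y => ∑' n, ‖cut (fun n => (y : LP 1) n) r n‖)
      (fun r x c => by
        have h1 : dist x c = ∑' n, ‖(x : LP 1) n - (c : LP 1) n‖ := by
          rw [dist_eq_norm]
          exact (hasSum_norm_lp_one ((x - c : l1) : LP 1)).tsum_eq.symm
        have h2 : Summable fun n => ‖(x : LP 1) n - (c : LP 1) n‖ :=
          (hasSum_norm_lp_one ((x - c : l1) : LP 1)).summable
        rw [one_mul, h1, ← (hs c r).tsum_add h2]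
        refine (hs x r).tsum_le_tsum (fun n => ?_) ((hs c r).add h2)
        unfold cut
        split_ifs
        · simp
        · have := norm_add_le ((c : LP 1) n) ((x : LP 1) n - (c : LP 1) n)
          rwa [add_sub_cancel] at this)
      (fun c => by
        have := tendsto_tsum_of_dominated_convergence (𝓕 := atTop)
          (f := fun r n => ‖cut (fun n => (c : LP 1) n) r n‖) (g := fun _ : ℕ => (0 : ℝ))
          (hasSum_norm_lp_one (c : LP 1)).summable
          (fun n => by
            refine tendsto_const_nhds.congr' ?_
            filter_upwards [eventually_ge_atTop n] with r hr
            simp [cut, hr])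
          (Eventually.of_forall fun r n => by
            rw [norm_norm]
            exact norm_cut_le (fun n => (c : LP 1) n) r n)
        simpa using this)
    obtain ⟨r, hr⟩ := eventually_atTop.1 hev
    refine ⟨r, iSup_le fun N => ?_⟩
    rw [← ofReal_norm]
    refine ENNReal.ofReal_le_ofReal (opNorm_le_of_unit_ball _ fun x hx => ?_)
    refine le_trans ?_ (hr r le_rfl _ ⟨x, hx, rfl⟩)
    rw [sum_apply]
    refine (norm_sum_le _ _).trans ?_
    simp only [hL, cut_apply_clm]
    exact (hsum x r).sum_le_tsum N fun _ _ => norm_nonneg _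
  · suffices chi (T '' Metric.ball 0 1) / 4 ≤ l by linarith
    refine le_coe_of_tendsto hl fun r => ?_
    rw [ENNReal.ofReal_le_iff_le_toReal (hfin r), div_le_iff₀' (by norm_num)]
    have hY : ∀ k, lp.single 1 k (1 : ℂ) ∈ l1 := fun k => Submodule.mem_top
    -- `r + 1` coordinates are removed because `cut` also kills the index `r`.
    refine chi_le_of_finite_rank T (fun i : Fin (r + 1) => φ i)
      (fun i => ⟨lp.single 1 (i : ℕ) 1, hY i⟩) (by positivity) fun x hx => ?_
    refine norm_le_of_sum_coord_le _ (by positivity) fun s => ?_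
    refine sum_norm_le_four_mul s _ fun t _ => ?_
    have e : ∀ n, ((T x - ∑ i : Fin (r + 1), φ i x • (⟨lp.single 1 (i : ℕ) 1, hY i⟩ : l1) : l1) :
        LP 1) n = cut φ r n x := by
      intro n
      rw [Submodule.coe_sub, lp.coeFn_sub, Pi.sub_apply,
        sum_smul_single_apply hY (fun i => φ i x) (r + 1) n, hL, cut_apply_clm]
      unfold cut
      split_ifs <;> first | omega | simp
    simp only [e]
    rw [← sum_apply]
    refine (ContinuousLinearMap.unit_le_opNorm _ x (mem_ball_zero_iff.1 hx).le).trans ?_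
    rw [← toReal_enorm]
    exact ENNReal.toReal_mono (hfin r) (le_iSup (fun N : Finset ℕ => ‖∑ n ∈ N, cut φ r n‖ₑ) t)

end Coordinates

/-! ### Functionals on the sequence spaces -/

section Dual

variable {E : Type*} [NormedAddCommGroup E] [NormedSpace ℂ E] (φ : E →L[ℂ] ℂ)

theorem dual_add (x y : E) : φ (x + y) = φ x + φ y := map_add φ x y

theorem dual_sub (x y : E) : φ (x - y) = φ x - φ y := map_sub φ x y

theorem dual_smul (a : ℂ) (x : E) : φ (a • x) = a * φ x := map_smul φ a x

theorem dual_sum (s : Finset ℕ) (b : ℕ → E) : φ (∑ k ∈ s, b k) = ∑ k ∈ s, φ (b k) :=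
  map_sum φ b s

theorem dual_sum_smul (s : Finset ℕ) (u : ℕ → ℂ) (b : ℕ → E) :
    φ (∑ k ∈ s, u k • b k) = ∑ k ∈ s, u k * φ (b k) := by
  simp [map_sum]

end Dual

/-- The coordinate functionals. -/
def coord (X : Submodule ℂ (LP ∞)) (k : ℕ) : X →L[ℂ] ℂ :=
  (lp.evalCLM ℂ (fun _ : ℕ => ℂ) ∞ k).comp X.subtypeL

theorem coord_apply (X : Submodule ℂ (LP ∞)) (k : ℕ) (z : X) : coord X k z = (z : LP ∞) k := rfl

section Unit

variable {X : Submodule ℂ (LP ∞)}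

/-- The unit sequences. -/
def unit (hX : null ≤ X) (k : ℕ) : X := ⟨lp.single ∞ k 1, hX (single_mem_null k 1)⟩

theorem unit_apply (hX : null ≤ X) (k n : ℕ) :
    (unit hX k : LP ∞) n = if n = k then 1 else 0 := by
  change (lp.single ∞ k 1 : LP ∞) n = _
  rw [lp.single_apply]
  by_cases h : n = k
  · subst h; simp
  · simp [h]

theorem coord_unit (hX : null ≤ X) (k n : ℕ) : coord X n (unit hX k) = if n = k then 1 else 0 :=
  unit_apply hX k n

theorem ext_coord {z w : X} (h : ∀ k, coord X k z = coord X k w) : z = w :=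
  Subtype.ext (lp.ext (funext h))

theorem norm_le_of_coord {z : X} {C : ℝ} (hC : 0 ≤ C) (h : ∀ k, ‖coord X k z‖ ≤ C) : ‖z‖ ≤ C :=
  norm_le_of_coord_le z hC h

theorem coord_sum_unit (hX : null ≤ X) (s : Finset ℕ) (u : ℕ → ℂ) (n : ℕ) :
    coord X n (∑ k ∈ s, u k • unit hX k) = if n ∈ s then u n else 0 := by
  rw [dual_sum_smul]
  simp [coord_unit]

theorem exists_unimodular_mul (z : ℂ) : ∃ u : ℂ, ‖u‖ ≤ 1 ∧ u * z = (‖z‖ : ℂ) := by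
  rcases eq_or_ne z 0 with rfl | h
  · exact ⟨0, by simp, by simp⟩
  · have h' : (‖z‖ : ℂ) ≠ 0 := by simpa using h
    refine ⟨(starRingEnd ℂ) z / ‖z‖, by simp [h], ?_⟩
    rw [div_mul_eq_mul_div, Complex.conj_mul', sq, mul_div_assoc, div_self h', mul_one]

/-- The test vector has, at each index of `s`, a coefficient of modulus at most `1` that rotates the
corresponding value of `φ` onto the positive axis. -/
theorem sum_norm_unit_le (hX : null ≤ X) (φ : X →L[ℂ] ℂ) (s : Finset ℕ) :
    ∑ k ∈ s, ‖φ (unit hX k)‖ ≤ ‖φ‖ := by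
  choose u hu hu' using fun k => exists_unimodular_mul (φ (unit hX k))
  have h1 : ‖∑ k ∈ s, u k • unit hX k‖ ≤ 1 := by
    refine norm_le_of_coord zero_le_one fun n => ?_
    rw [coord_sum_unit]
    split_ifs
    · exact hu n
    · simp
  have h2 := φ.unit_le_opNorm _ h1
  have h3 : φ (∑ k ∈ s, u k • unit hX k) = ((∑ k ∈ s, ‖φ (unit hX k)‖ : ℝ) : ℂ) := by
    rw [dual_sum_smul]
    simp [hu']
  rwa [h3, Complex.norm_real, Real.norm_of_nonneg (Finset.sum_nonneg fun _ _ => norm_nonneg _)]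
    at h2

theorem summable_norm_unit (hX : null ≤ X) (φ : X →L[ℂ] ℂ) :
    Summable fun k => ‖φ (unit hX k)‖ :=
  summable_of_sum_le (fun _ => norm_nonneg _) (sum_norm_unit_le hX φ)

theorem norm1_eq_ofReal {x : Seq} (h : Summable fun k => ‖x k‖) :
    norm1 x = ENNReal.ofReal (∑' k, ‖x k‖) := by
  unfold norm1
  rw [ENNReal.ofReal_tsum_of_nonneg (fun _ => norm_nonneg _) h]
  simp only [ofReal_norm]

/-- The functionals that are represented by a series. -/
def IsSeries (hX : null ≤ X) (φ : X →L[ℂ] ℂ) : Prop :=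
  ∀ z : X, HasSum (fun k => φ (unit hX k) * coord X k z) (φ z)

theorem IsSeries.zero (hX : null ≤ X) : IsSeries hX 0 := fun z => by simp

theorem IsSeries.sub {hX : null ≤ X} {φ ψ : X →L[ℂ] ℂ} (hφ : IsSeries hX φ) (hψ : IsSeries hX ψ) :
    IsSeries hX (φ - ψ) := fun z => by
  simpa [sub_mul] using (hφ z).sub (hψ z)

theorem IsSeries.smul {hX : null ≤ X} {φ : X →L[ℂ] ℂ} (a : ℂ) (hφ : IsSeries hX φ) :
    IsSeries hX (a • φ) := fun z => by
  simpa [mul_assoc] using (hφ z).mul_left a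

theorem IsSeries.sum {hX : null ≤ X} {ι : Type*} {s : Finset ι} {φ : ι → X →L[ℂ] ℂ}
    (h : ∀ i ∈ s, IsSeries hX (φ i)) : IsSeries hX (∑ i ∈ s, φ i) := fun z => by
  simpa [Finset.sum_mul] using hasSum_sum fun i hi => h i hi z

theorem IsSeries.coord (hX : null ≤ X) (n : ℕ) : IsSeries hX (coord X n) := fun z => by
  have := hasSum_single (f := fun k => FracSeq.coord X n (unit hX k) * FracSeq.coord X k z) n
    (fun k hk => by simp [coord_unit, hk.symm])
  simpa [coord_unit] using this

theorem IsSeries.enorm_eq {hX : null ≤ X} {φ : X →L[ℂ] ℂ} (hφ : IsSeries hX φ) :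
    ‖φ‖ₑ = norm1 fun k => φ (unit hX k) := by
  have hs := summable_norm_unit hX φ
  rw [norm1_eq_ofReal hs, ← ofReal_norm]
  congr 1
  refine le_antisymm (φ.opNorm_le_bound (tsum_nonneg fun _ => norm_nonneg _) fun z => ?_)
    (hs.tsum_le_of_sum_le (sum_norm_unit_le hX φ))
  rw [← (hφ z).tsum_eq, ← tsum_mul_right]
  refine tsum_of_norm_bounded (hs.mul_right ‖z‖).hasSum fun k => ?_
  rw [norm_mul]
  exact mul_le_mul_of_nonneg_left (norm_coord_le z k) (norm_nonneg _)

end Unit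

/-! #### Null sequences -/

/-- The unit sequences form an unconditional basis of `c_0`, and a continuous functional can be
applied term by term. -/
theorem isSeries_null (φ : null →L[ℂ] ℂ) : IsSeries le_rfl φ := by
  intro z
  have h1 : HasSum (fun k => coord null k z • unit le_rfl k) z := by
    rw [HasSum, SummationFilter.unconditional_filter, Metric.tendsto_atTop]
    intro ε hε
    obtain ⟨N, hN⟩ := Metric.tendsto_atTop.1
      (show Tendsto (fun n => (z : LP ∞) n) atTop (𝓝 0) from z.2) (ε / 2) (by positivity)
    refine ⟨Finset.range N, fun s hs => ?_⟩
    refine lt_of_le_of_lt ?_ (half_lt_self hε)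
    rw [dist_eq_norm]
    refine norm_le_of_coord (by positivity) fun n => ?_
    rw [dual_sub, coord_sum_unit]
    split_ifs with h
    · simpa using (half_pos hε).le
    · have : N ≤ n := not_lt.1 fun h' => h (hs (Finset.mem_range.2 h'))
      rw [zero_sub, norm_neg, coord_apply]
      simpa using (hN n this).le
  simpa [mul_comm] using h1.mapL φ

/-! #### Bounded sequences -/

/-- The bounded sequence given by a point of the product of unit disks. -/
def ofDisks (w : ℕ → Metric.closedBall (0 : ℂ) 1) : linf :=
  ⟨⟨fun k => (w k : ℂ), memℓp_infty ⟨1, by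
    rintro _ ⟨k, rfl⟩
    exact mem_closedBall_zero_iff.1 (w k).2⟩⟩, Submodule.mem_top⟩

theorem coord_ofDisks (w : ℕ → Metric.closedBall (0 : ℂ) 1) (k : ℕ) :
    coord linf k (ofDisks w) = w k := rfl

/-- The topology is the product topology, weaker than that of the norm; summability of the
coefficients gives continuity by the Weierstrass test. This is what makes Baire's theorem usable on
the product of disks. -/
theorem IsSeries.continuous_ofDisks {φ : linf →L[ℂ] ℂ} (hφ : IsSeries le_top φ) :
    Continuous fun w => φ (ofDisks w) := by
  have : (fun w => φ (ofDisks w)) = fun w => ∑' k, φ (unit le_top k) * (w k : ℂ) :=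
    funext fun w => ((hφ (ofDisks w)).tsum_eq).symm
  rw [this]
  refine continuous_tsum (fun k => by fun_prop) (summable_norm_unit le_top φ) fun k w => ?_
  rw [norm_mul]
  exact mul_le_of_le_one_right (norm_nonneg _) (mem_closedBall_zero_iff.1 (w k).2)

/-- On `ℓ_∞`, the functionals represented by series are sequentially closed under pointwise
convergence. -/
theorem isSeries_linf_of_tendsto {φ : ℕ → linf →L[ℂ] ℂ} (hφ : ∀ n, IsSeries le_top (φ n))
    {ψ : linf →L[ℂ] ℂ} (h : ∀ z, Tendsto (fun n => φ n z) atTop (𝓝 (ψ z))) :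
    IsSeries le_top ψ := by
  have zero_mem : (0 : ℂ) ∈ Metric.closedBall (0 : ℂ) 1 := by simp
  -- a uniform estimate off a finite set of coordinates, from Baire's theorem
  have key : ∀ ε : ℝ, 0 < ε → ∃ (I : Finset ℕ) (M : ℕ), ∀ w : ℕ → Metric.closedBall (0 : ℂ) 1,
      (∀ k ∈ I, (w k : ℂ) = 0) → ‖φ M (ofDisks w) - ψ (ofDisks w)‖ ≤ 2 * ε := by
    intro ε hε
    set F : ℕ → Set (ℕ → Metric.closedBall (0 : ℂ) 1) := fun M =>
      {w | ∀ N ≥ M, ‖φ M (ofDisks w) - φ N (ofDisks w)‖ ≤ ε} with hF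
    have hcl : ∀ M, IsClosed (F M) := by
      intro M
      simp only [hF, Set.ofPred_forall]
      exact isClosed_iInter fun N => isClosed_iInter fun _ => isClosed_le
        ((hφ M).continuous_ofDisks.sub (hφ N).continuous_ofDisks).norm continuous_const
    have hun : ⋃ M, F M = Set.univ := by
      refine Set.eq_univ_of_forall fun w => ?_
      obtain ⟨M, hM⟩ := Metric.cauchySeq_iff.1 (h (ofDisks w)).cauchySeq ε hε
      refine Set.mem_iUnion.2 ⟨M, fun N hN => ?_⟩
      rw [← dist_eq_norm]
      exact (hM M le_rfl N hN).le
    obtain ⟨M, w₀, hw₀⟩ := nonempty_interior_of_iUnion_of_closed hcl hun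
    -- A basic open set of the product restricts only the finitely many coordinates in `I`; the
    -- others remain free.
    obtain ⟨I, u, hu, hIu⟩ := isOpen_pi_iff.1 isOpen_interior w₀ hw₀
    have hmem : ∀ w : ℕ → Metric.closedBall (0 : ℂ) 1, (∀ k ∈ I, w k = w₀ k) → w ∈ F M := by
      intro w hw
      refine interior_subset (hIu fun k hk => ?_)
      rw [hw k hk]
      exact (hu k hk).2
    refine ⟨I, M, fun w hw => ?_⟩
    have hw1 := hmem (fun k => if k ∈ I then w₀ k else w k) (fun k hk => by simp [hk])
    have hw2 := hmem (fun k => if k ∈ I then w₀ k else ⟨0, zero_mem⟩) (fun k hk => by simp [hk])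
    set z1 := ofDisks fun k => if k ∈ I then w₀ k else w k
    set z2 := ofDisks fun k => if k ∈ I then w₀ k else ⟨0, zero_mem⟩
    -- A point vanishing on `I` is a difference of two points agreeing with `w₀` on `I`, hence the
    -- bound `2 * ε`.
    have e : ofDisks w = z1 - z2 := by
      refine ext_coord fun k => ?_
      rw [dual_sub]
      simp only [z1, z2, coord_ofDisks]
      by_cases hk : k ∈ I
      · simp [hk, hw k hk]
      · simp [hk]
    have hlim : Tendsto (fun N => ‖φ M (ofDisks w) - φ N (ofDisks w)‖) atTop
        (𝓝 ‖φ M (ofDisks w) - ψ (ofDisks w)‖) := (tendsto_const_nhds.sub (h _)).norm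
    refine le_of_tendsto hlim ?_
    filter_upwards [eventually_ge_atTop M] with N hN
    have e2 : φ M (ofDisks w) - φ N (ofDisks w) =
        (φ M z1 - φ N z1) - (φ M z2 - φ N z2) := by
      rw [e, dual_sub, dual_sub]
      ring
    rw [e2]
    have h1 : ‖φ M z1 - φ N z1‖ ≤ ε := hw1 N hN
    have h2 : ‖φ M z2 - φ N z2‖ ≤ ε := hw2 N hN
    linarith [norm_sub_le (φ M z1 - φ N z1) (φ M z2 - φ N z2)]
  have hball : ∀ w, HasSum (fun k => ψ (unit le_top k) * coord linf k (ofDisks w))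
      (ψ (ofDisks w)) := by
    intro w
    rw [HasSum, SummationFilter.unconditional_filter, Metric.tendsto_atTop]
    intro ε hε
    obtain ⟨I, M, hIM⟩ := key (ε / 4) (by positivity)
    have hM := hφ M (ofDisks w)
    rw [HasSum, SummationFilter.unconditional_filter, Metric.tendsto_atTop] at hM
    obtain ⟨J, hJ⟩ := hM (ε / 2) (by positivity)
    refine ⟨I ∪ J, fun s hs => ?_⟩
    -- The value of `ψ` at `v` is the error of the partial sum over `s`. It is close to `φ M` at
    -- `v`, since `v` vanishes on `I`, and the latter is small because `φ M` is a series.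
    set v : ℕ → Metric.closedBall (0 : ℂ) 1 := fun k => if k ∈ s then ⟨0, zero_mem⟩ else w k
    have hv : ofDisks v = ofDisks w - ∑ k ∈ s, coord linf k (ofDisks w) • unit le_top k := by
      refine ext_coord fun k => ?_
      rw [dual_sub, coord_sum_unit]
      simp only [v, coord_ofDisks]
      by_cases hk : k ∈ s <;> simp [hk]
    have hval : ∀ θ : linf →L[ℂ] ℂ, θ (ofDisks v) =
        θ (ofDisks w) - ∑ k ∈ s, θ (unit le_top k) * coord linf k (ofDisks w) := by
      intro θ
      rw [hv, dual_sub, dual_sum_smul]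
      simp only [mul_comm]
    have h1 := hIM v fun k hk => by
      simp [v, hs (Finset.mem_union_left _ hk)]
    have h2 := hJ s (Finset.union_subset_right hs)
    rw [dist_comm, dist_eq_norm, ← hval] at h2 ⊢
    have h3 := norm_le_norm_add_norm_sub (φ M (ofDisks v)) (ψ (ofDisks v))
    linarith
  intro z
  have hR : 0 < ‖z‖ + 1 := by positivity
  have hRC : ((‖z‖ + 1 : ℝ) : ℂ) ≠ 0 := by exact_mod_cast hR.ne'
  set w : ℕ → Metric.closedBall (0 : ℂ) 1 := fun k => ⟨((‖z‖ + 1 : ℝ) : ℂ)⁻¹ * coord linf k z, by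
    rw [mem_closedBall_zero_iff, norm_mul, norm_inv, Complex.norm_real,
      Real.norm_of_nonneg hR.le, inv_mul_le_one₀ hR]
    have : ‖coord linf k z‖ ≤ ‖z‖ := norm_coord_le z k
    linarith⟩
  have e : z = ((‖z‖ + 1 : ℝ) : ℂ) • ofDisks w := by
    refine ext_coord fun k => ?_
    rw [dual_smul, coord_ofDisks, mul_inv_cancel_left₀ hRC]
  have h2 := (hball w).mul_left ((‖z‖ + 1 : ℝ) : ℂ)
  rw [← dual_smul, ← e] at h2
  have hk : ∀ k, coord linf k z = ((‖z‖ + 1 : ℝ) : ℂ) * coord linf k (ofDisks w) := fun k => by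
    rw [coord_ofDisks, mul_inv_cancel_left₀ hRC]
  refine h2.congr_fun fun k => ?_
  rw [hk k]
  ring

theorem isSeries_of_tendsto {X : Submodule ℂ (LP ∞)} (hX : X = linf ∨ X = null) (hX' : null ≤ X)
    {φ : ℕ → X →L[ℂ] ℂ} (hφ : ∀ n, IsSeries hX' (φ n))
    {ψ : X →L[ℂ] ℂ} (h : ∀ z, Tendsto (fun n => φ n z) atTop (𝓝 (ψ z))) : IsSeries hX' ψ := by
  rcases hX with rfl | rfl
  · exact isSeries_linf_of_tendsto hφ h
  · exact isSeries_null ψ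

/-! #### Convergent sequences -/

/-- The part at infinity of a functional on `c`. -/
def partInf (φ : conv →L[ℂ] ℂ) : ℂ := ∑' k, φ (unit null_le_conv k) - φ (tailOne 0)

theorem coord_tailOne (r n : ℕ) : coord conv n (tailOne r) = if n < r then 0 else 1 :=
  tailOne_apply r n

theorem tailOne_eq (r : ℕ) : tailOne r = tailOne 0 - ∑ k ∈ Finset.range r, unit null_le_conv k := by
  refine ext_coord fun n => ?_
  have := coord_sum_unit null_le_conv (Finset.range r) (fun _ => 1) n
  simp only [one_smul] at this
  rw [dual_sub, this, coord_tailOne, coord_tailOne]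
  by_cases h : n < r <;> simp [h]

/-- The sign of `partInf` is the one for which it becomes `γ_n` on rows; the mass that `φ` puts at
infinity is its negative. -/
theorem tendsto_tailOne (φ : conv →L[ℂ] ℂ) :
    Tendsto (fun r => φ (tailOne r)) atTop (𝓝 (-partInf φ)) := by
  have h := (summable_norm_unit null_le_conv φ).of_norm.hasSum.tendsto_sum_nat
  have h2 := (tendsto_const_nhds (x := φ (tailOne 0))).sub h
  have e : -partInf φ = φ (tailOne 0) - ∑' k, φ (unit null_le_conv k) := neg_sub _ _
  rw [e]
  refine h2.congr fun r => ?_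
  rw [tailOne_eq r, dual_sub, dual_sum]

theorem conv_repr (φ : conv →L[ℂ] ℂ) (z : conv) :
    φ z = ∑' k, φ (unit null_le_conv k) * coord conv k z - partInf φ * limCLM z := by
  -- A convergent sequence is the norm limit of its truncations continued by the constant `lim z`.
  have hz : Tendsto (fun r => ∑ k ∈ Finset.range r, coord conv k z • unit null_le_conv k +
      limCLM z • tailOne r) atTop (𝓝 z) := by
    rw [Metric.tendsto_atTop]
    intro ε hε
    obtain ⟨N, hN⟩ := Metric.tendsto_atTop.1 (tendsto_limCLM z) (ε / 2) (by positivity)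
    refine ⟨N, fun r hr => ?_⟩
    refine lt_of_le_of_lt ?_ (half_lt_self hε)
    rw [dist_comm, dist_eq_norm]
    refine norm_le_of_coord (by positivity) fun n => ?_
    rw [dual_sub, dual_add, coord_sum_unit, dual_smul, coord_tailOne]
    by_cases h : n < r
    · simpa [h] using (half_pos hε).le
    · have := (hN n (hr.trans (not_lt.1 h))).le
      rw [dist_eq_norm] at this
      simpa [h, coord_apply] using this
  have h1 := (φ.continuous.tendsto z).comp hz
  have hs : Summable fun k => φ (unit null_le_conv k) * coord conv k z := by
    refine Summable.of_norm_bounded ((summable_norm_unit null_le_conv φ).mul_right ‖z‖) fun k => ?_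
    rw [norm_mul]
    exact mul_le_mul_of_nonneg_left (norm_coord_le z k) (norm_nonneg _)
  have h2 := hs.hasSum.tendsto_sum_nat.add ((tendsto_tailOne φ).const_mul (limCLM z))
  refine (tendsto_nhds_unique h1 (h2.congr fun r => ?_)).trans (by ring)
  simp only [Function.comp_apply, dual_add, dual_sum_smul, dual_smul, mul_comm]

theorem sum_norm_unit_add_le (φ : conv →L[ℂ] ℂ) (r : ℕ) :
    ∑ k ∈ Finset.range r, ‖φ (unit null_le_conv k)‖ + ‖φ (tailOne r)‖ ≤ ‖φ‖ := by
  choose u hu hu' using fun k => exists_unimodular_mul (φ (unit null_le_conv k))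
  obtain ⟨v, hv, hv'⟩ := exists_unimodular_mul (φ (tailOne r))
  have h1 : ‖∑ k ∈ Finset.range r, u k • unit null_le_conv k + v • tailOne r‖ ≤ 1 := by
    refine norm_le_of_coord zero_le_one fun n => ?_
    rw [dual_add, coord_sum_unit, dual_smul, coord_tailOne]
    by_cases h : n < r
    · simpa [h] using hu n
    · simpa [h] using hv
  have h2 := φ.unit_le_opNorm _ h1
  have h3 : φ (∑ k ∈ Finset.range r, u k • unit null_le_conv k + v • tailOne r) =
      ((∑ k ∈ Finset.range r, ‖φ (unit null_le_conv k)‖ + ‖φ (tailOne r)‖ : ℝ) : ℂ) := by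
    rw [dual_add, dual_sum_smul, dual_smul]
    simp [hu', hv']
  rwa [h3, Complex.norm_real, Real.norm_of_nonneg (by positivity)] at h2

/-- The upper bound is read off from `conv_repr`. For the lower one, the coefficients on an initial
segment and on the constant tail can be rotated independently (`sum_norm_unit_add_le`), and the
segment then grows. -/
theorem enorm_conv (φ : conv →L[ℂ] ℂ) :
    ‖φ‖ₑ = norm1 (fun k => φ (unit null_le_conv k)) + ‖partInf φ‖ₑ := by
  have hs := summable_norm_unit null_le_conv φ
  rw [norm1_eq_ofReal hs, ← ofReal_norm, ← ofReal_norm,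
    ← ENNReal.ofReal_add (tsum_nonneg fun _ => norm_nonneg _) (norm_nonneg _)]
  congr 1
  refine le_antisymm (φ.opNorm_le_bound (by positivity) fun z => ?_) ?_
  · rw [conv_repr φ z, add_mul]
    refine (norm_sub_le _ _).trans (add_le_add ?_ ?_)
    · rw [← tsum_mul_right]
      refine tsum_of_norm_bounded (hs.mul_right ‖z‖).hasSum fun k => ?_
      rw [norm_mul]
      exact mul_le_mul_of_nonneg_left (norm_coord_le z k) (norm_nonneg _)
    · rw [norm_mul]
      exact mul_le_mul_of_nonneg_left (norm_limCLM_le z) (norm_nonneg _)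
  · have h := hs.hasSum.tendsto_sum_nat.add (tendsto_tailOne φ).norm
    rw [norm_neg] at h
    exact le_of_tendsto' h (sum_norm_unit_add_le φ)

theorem partInf_sub (φ ψ : conv →L[ℂ] ℂ) : partInf (φ - ψ) = partInf φ - partInf ψ := by
  unfold partInf
  have h1 := (summable_norm_unit null_le_conv φ).of_norm
  have h2 := (summable_norm_unit null_le_conv ψ).of_norm
  simp only [sub_apply]
  rw [h1.tsum_sub h2]
  ring

theorem partInf_sum (s : Finset ℕ) (φ : ℕ → conv →L[ℂ] ℂ) :
    partInf (∑ n ∈ s, φ n) = ∑ n ∈ s, partInf (φ n) := by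
  unfold partInf
  simp only [sum_apply, Finset.sum_sub_distrib]
  rw [Summable.tsum_finsetSum fun n _ => (summable_norm_unit null_le_conv (φ n)).of_norm]

/-! ### Inversion of the fractional difference operator -/

/-- The generating function of the fractional differences of order `α`. -/
def fracSeries (α : ℝ) : PowerSeries ℂ :=
  PowerSeries.mk fun i => (((-1) ^ i * Ring.choose α i : ℝ) : ℂ)

theorem Delta_eq_coeff (α : ℝ) (x : Seq) (n : ℕ) :
    Delta α x n = PowerSeries.coeff n (PowerSeries.mk x * fracSeries α) := by
  rw [PowerSeries.coeff_mul, Finset.Nat.sum_antidiagonal_eq_sum_range_succ_mk]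
  change ∑ k ∈ Finset.range (n + 1), (fracDiff α n k : ℂ) * x k = _
  refine Finset.sum_congr rfl fun k hk => ?_
  have : k ≤ n := Nat.lt_succ_iff.1 (Finset.mem_range.1 hk)
  simp only [fracSeries, PowerSeries.coeff_mk, fracDiff, if_pos this]
  ring

/-- This is `(1 - X)^α (1 - X)^(-α) = 1`; coefficientwise it is the Chu–Vandermonde identity. -/
theorem fracSeries_mul (α : ℝ) : fracSeries α * fracSeries (-α) = 1 := by
  ext n
  have h := Ring.add_choose_eq n (Commute.all α (-α))
  rw [add_neg_cancel] at h
  have h0 : Ring.choose (0 : ℝ) n = if n = 0 then 1 else 0 := by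
    rcases n with _ | n
    · simp
    · simp [Ring.choose_zero_succ]
  rw [PowerSeries.coeff_mul, PowerSeries.coeff_one]
  have e : ∑ p ∈ Finset.HasAntidiagonal.antidiagonal n, PowerSeries.coeff p.1 (fracSeries α) *
      PowerSeries.coeff p.2 (fracSeries (-α)) =
      (((-1) ^ n * ∑ p ∈ Finset.HasAntidiagonal.antidiagonal n,
        Ring.choose α p.1 * Ring.choose (-α) p.2 : ℝ) : ℂ) := by
    rw [Finset.mul_sum, Complex.ofReal_sum]
    refine Finset.sum_congr rfl fun p hp => ?_
    rw [← Finset.HasAntidiagonal.mem_antidiagonal.1 hp]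
    simp only [fracSeries, PowerSeries.coeff_mk]
    push_cast
    ring
  rw [e, ← h, h0]
  split_ifs with hn
  · simp [hn]
  · simp

theorem Delta_Delta_neg (α : ℝ) (x : Seq) : Delta α (Delta (-α) x) = x := by
  have h1 : PowerSeries.mk (Delta (-α) x) = PowerSeries.mk x * fracSeries (-α) := by
    ext n
    rw [PowerSeries.coeff_mk, Delta_eq_coeff]
  ext n
  rw [Delta_eq_coeff, h1, mul_assoc, mul_comm (fracSeries (-α)), fracSeries_mul, mul_one,
    PowerSeries.coeff_mk]

theorem Delta_neg_Delta (α : ℝ) (x : Seq) : Delta (-α) (Delta α x) = x := by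
  have := Delta_Delta_neg (-α) x
  rwa [neg_neg] at this

/-- The underlying sequence of an element of a sequence space. -/
def toSeq {X : Submodule ℂ (LP ∞)} (z : X) : Seq := fun n => (z : LP ∞) n

/-- The isometry `x ↦ Δ^(α) x` of `X(Δ^(α))` onto `X`. -/
def fracEquiv (α : ℝ) (X : Submodule ℂ (LP ∞)) : FracSpace α X ≃ᵢ X where
  toFun x := ⟨FracSpace.transform x, (Classical.choose_spec x.seq_mem).1⟩
  invFun z := ⟨Delta (-α) (toSeq z), ⟨z, z.2, (Delta_Delta_neg α (toSeq z)).symm⟩⟩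
  left_inv x := by
    refine Subtype.ext (Eq.trans ?_ (Delta_neg_Delta α x.seq))
    exact congrArg (Delta (-α)) (funext (FracSpace.transform_apply x))
  right_inv z := by
    refine Subtype.ext (lp.ext (funext fun n => ?_))
    exact (FracSpace.transform_apply _ n).trans (congrFun (Delta_Delta_neg α (toSeq z)) n)
  isometry_toFun := Isometry.of_dist_eq fun _ _ => rfl

/-! ### Invariance under isometries -/

section Isometry

variable {E E' F : Type*} [PseudoMetricSpace E] [PseudoMetricSpace E'] [PseudoMetricSpace F]

theorem cover_image_isometryEquiv (e : E ≃ᵢ E') {Q : Set E} {ε : ℝ}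
    (h : ∃ (n : ℕ) (c : Fin n → E) (d : Fin n → ℝ),
      (∀ i, d i < ε) ∧ Q ⊆ ⋃ i, Metric.ball (c i) (d i)) :
    ∃ (n : ℕ) (c : Fin n → E') (d : Fin n → ℝ),
      (∀ i, d i < ε) ∧ e '' Q ⊆ ⋃ i, Metric.ball (c i) (d i) := by
  obtain ⟨n, c, d, hd, hc⟩ := h
  refine ⟨n, e ∘ c, d, hd, ?_⟩
  rintro _ ⟨x, hx, rfl⟩
  obtain ⟨i, hi⟩ := Set.mem_iUnion.1 (hc hx)
  exact Set.mem_iUnion.2 ⟨i, by simpa [Metric.mem_ball, e.isometry.dist_eq] using hi⟩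

theorem chi_image_isometryEquiv (e : E ≃ᵢ E') (Q : Set E) : chi (e '' Q) = chi Q := by
  unfold chi
  congr 1
  ext ε
  refine and_congr_right fun _ => ⟨fun h => ?_, cover_image_isometryEquiv e⟩
  have h2 := cover_image_isometryEquiv e.symm h
  rwa [Set.image_image, show (fun x => e.symm (e x)) '' Q = Q by simp] at h2

theorem isBounded_image_isometryEquiv (e : E ≃ᵢ E') {Q : Set E} :
    Bornology.IsBounded (e '' Q) ↔ Bornology.IsBounded Q := by
  refine ⟨fun h => ?_, fun h => e.isometry.lipschitz.isBounded_image h⟩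
  have h2 := e.symm.isometry.lipschitz.isBounded_image h
  rwa [Set.image_image, show (fun x => e.symm (e x)) '' Q = Q by simp] at h2

theorem chiBound_comp_iff (L : E' → F) (e : E ≃ᵢ E') (C : ℝ) :
    (∀ Q : Set E, Bornology.IsBounded Q → chi ((L ∘ e) '' Q) ≤ C * chi Q) ↔
      ∀ Q : Set E', Bornology.IsBounded Q → chi (L '' Q) ≤ C * chi Q := by
  rw [(Set.image_surjective.2 e.surjective).forall]
  simp only [Set.image_comp, chi_image_isometryEquiv, isBounded_image_isometryEquiv]

theorem chiNorm_comp_isometryEquiv (L : E' → F) (e : E ≃ᵢ E') : chiNorm (L ∘ e) = chiNorm L := by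
  unfold chiNorm
  simp only [chiBound_comp_iff]

theorem chiBounded_comp_isometryEquiv {L : E' → F} (e : E ≃ᵢ E') (h : ChiBounded L) :
    ChiBounded (L ∘ e) := by
  refine ⟨fun Q hQ => ?_, ?_⟩
  · rw [Set.image_comp]
    exact h.1 _ ((isBounded_image_isometryEquiv e).2 hQ)
  · obtain ⟨C, hC, h2⟩ := h.2
    exact ⟨C, hC, (chiBound_comp_iff L e C).2 h2⟩

end Isometry

/-! ### The rows of a matrix as functionals -/

/-- Banach–Steinhaus. It is used twice: for partial sums within a row, and for the rows themselves
when `Y = c`. -/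
theorem exists_dual_of_tendsto {E : Type*} [NormedAddCommGroup E] [NormedSpace ℂ E]
    [CompleteSpace E] (φ : ℕ → E →L[ℂ] ℂ) (h : ∀ x, ∃ l, Tendsto (fun n => φ n x) atTop (𝓝 l)) :
    ∃ ψ : E →L[ℂ] ℂ, ∀ x, Tendsto (fun n => φ n x) atTop (𝓝 (ψ x)) := by
  choose f hf using h
  exact ⟨continuousLinearMapOfTendsto φ (tendsto_pi_nhds.2 hf), hf⟩

section Rows

variable {α : ℝ} {A : Mat} {X : Submodule ℂ (LP ∞)}

/-- The `N`-th partial sum of the series of the `n`-th row, as a functional of `Δ^(α) x`. -/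
def partialRow (α : ℝ) (A : Mat) (X : Submodule ℂ (LP ∞)) (n N : ℕ) : X →L[ℂ] ℂ :=
  ∑ k ∈ Finset.range N, A n k • ∑ j ∈ Finset.range (k + 1), (fracDiff (-α) k j : ℂ) • coord X j

theorem partialRow_apply (n N : ℕ) (z : X) :
    partialRow α A X n N z = ∑ k ∈ Finset.range N, A n k * Delta (-α) (toSeq z) k := by
  simp only [partialRow, sum_apply, smul_apply, smul_eq_mul]
  rfl

theorem isSeries_partialRow (hX : null ≤ X) (n N : ℕ) : IsSeries hX (partialRow α A X n N) :=
  IsSeries.sum fun _ _ => (IsSeries.sum fun j _ => (IsSeries.coord hX j).smul _).smul _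

/-- The functional `φ n` on `X` is the `n`-th row of `A`, as a function of `Δ^(α) x`. -/
def IsRows (α : ℝ) (A : Mat) (φ : ℕ → X →L[ℂ] ℂ) : Prop :=
  ∀ n z, Tendsto (fun N => partialRow α A X n N z) atTop (𝓝 (φ n z))

theorem exists_isRows [CompleteSpace X] {W : Submodule ℂ Seq}
    (hA : A ∈ matClass (fracDomain α X) W) : ∃ φ : ℕ → X →L[ℂ] ℂ, IsRows α A φ := by
  have h : ∀ n, ∃ ψ : X →L[ℂ] ℂ, ∀ z, Tendsto (fun N => partialRow α A X n N z) atTop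
      (𝓝 (ψ z)) := by
    intro n
    refine exists_dual_of_tendsto _ fun z => ?_
    obtain ⟨l, hl⟩ := (hA _ ((fracEquiv α X).symm z).seq_mem).1 n
    exact ⟨l, hl.congr fun N => (partialRow_apply n N z).symm⟩
  choose φ hφ using h
  exact ⟨φ, hφ⟩

theorem IsRows.isSeries {φ : ℕ → X →L[ℂ] ℂ} (hφ : IsRows α A φ) (hX : X = linf ∨ X = null)
    (hX' : null ≤ X) (n : ℕ) : IsSeries hX' (φ n) :=
  isSeries_of_tendsto hX hX' (fun N => isSeries_partialRow hX' n N) (hφ n)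

/-- The operator `L_A`, transported to `X`. -/
def opOn {p : ℝ≥0∞} {Y : Submodule ℂ (LP p)} (hA : A ∈ matClass (fracDomain α X) (seqs Y))
    (z : X) : Y := matOp hA ((fracEquiv α X).symm z)

theorem opOn_apply {p : ℝ≥0∞} {Y : Submodule ℂ (LP p)}
    (hA : A ∈ matClass (fracDomain α X) (seqs Y)) {φ : ℕ → X →L[ℂ] ℂ} (hφ : IsRows α A φ) (z : X)
    (n : ℕ) : (opOn hA z : LP p) n = φ n z := by
  refine (matOp_apply hA _ n).trans (Tendsto.limUnder_eq ?_)
  exact (hφ n z).congr fun N => partialRow_apply n N z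

theorem matOp_eq_comp {p : ℝ≥0∞} {Y : Submodule ℂ (LP p)}
    (hA : A ∈ matClass (fracDomain α X) (seqs Y)) : matOp hA = opOn hA ∘ fracEquiv α X := by
  ext x : 1
  simp [opOn]

theorem chiNorm_matOp {p : ℝ≥0∞} [Fact (1 ≤ p)] {Y : Submodule ℂ (LP p)}
    (hA : A ∈ matClass (fracDomain α X) (seqs Y)) : chiNorm (matOp hA) = chiNorm (opOn hA) := by
  rw [matOp_eq_comp, chiNorm_comp_isometryEquiv]

theorem chiBounded_matOp {p : ℝ≥0∞} [Fact (1 ≤ p)] {Y : Submodule ℂ (LP p)}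
    {hA : A ∈ matClass (fracDomain α X) (seqs Y)} (h : ChiBounded (opOn hA)) :
    ChiBounded (matOp hA) := by
  rw [matOp_eq_comp]
  exact chiBounded_comp_isometryEquiv _ h

theorem Delta_unit (hX : null ≤ X) (β : ℝ) (k j : ℕ) :
    Delta β (toSeq (unit hX k)) j = fracDiff β j k := by
  change ∑ i ∈ Finset.range (j + 1), (fracDiff β j i : ℂ) * (unit hX k : LP ∞) i = _
  simp only [unit_apply, mul_ite, mul_one, mul_zero, Finset.sum_ite_eq', Finset.mem_range]
  split_ifs with h
  · rfl
  · simp [fracDiff, show ¬k ≤ j by omega]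

/-- `Δ^(-α)` sends the `k`-th unit sequence to its `k`-th column, so the row functional there is the
full series `∑_j s_jk a_nj`; its first `m` terms are then removed. -/
theorem IsRows.tendsto_tail {φ : ℕ → X →L[ℂ] ℂ} (hφ : IsRows α A φ) (hX : null ≤ X) (n k m : ℕ) :
    Tendsto (fun N => ∑ i ∈ Finset.range N, (fracDiff (-α) (m + i) k : ℂ) * A n (m + i)) atTop
      (𝓝 (φ n (unit hX k) - ∑ j ∈ Finset.range m, (fracDiff (-α) j k : ℂ) * A n j)) := by
  have h1 := (hφ n (unit hX k)).comp (tendsto_add_atTop_nat m)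
  refine (h1.sub_const _).congr fun N => ?_
  rw [Function.comp_apply, partialRow_apply, add_comm N m, Finset.sum_range_add]
  simp only [Delta_unit, mul_comm (A n _)]
  ring

theorem IsRows.hatExists {φ : ℕ → X →L[ℂ] ℂ} (hφ : IsRows α A φ) (hX : null ≤ X) :
    HatExists α A := fun n k m => ⟨_, hφ.tendsto_tail hX n k m⟩

theorem IsRows.hat_eq {φ : ℕ → X →L[ℂ] ℂ} (hφ : IsRows α A φ) (hX : null ≤ X) (n k : ℕ) :
    hat α A n k = φ n (unit hX k) := by
  refine (hφ.tendsto_tail hX n k k).limUnder_eq.trans ?_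
  rw [Finset.sum_eq_zero, sub_zero]
  intro j hj
  have := Finset.mem_range.1 hj
  simp [fracDiff, show ¬k ≤ j by omega]

theorem IsRows.tri_eq {φ : ℕ → X →L[ℂ] ℂ} (hφ : IsRows α A φ) (hX : null ≤ X) {n m k : ℕ}
    (h : k ≤ m) : tri α A n m k =
      φ n (unit hX k) - ∑ j ∈ Finset.range m, (fracDiff (-α) j k : ℂ) * A n j := by
  rw [tri, if_pos h]
  exact (hφ.tendsto_tail hX n k m).limUnder_eq

end Rows

/-! ### Rows as functionals on `c` -/

section RowsConv

variable {α : ℝ} {A : Mat} {φ : ℕ → conv →L[ℂ] ℂ}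

/-- After summing the tails over `k ≤ m` and exchanging the order, the removed terms are the `m`-th
partial row evaluated at the constant sequence `1`; their limit is the value of `φ n` there. -/
theorem IsRows.tendsto_gam (hφ : IsRows α A φ) (n : ℕ) :
    Tendsto (fun m => ∑ k ∈ Finset.range (m + 1), tri α A n m k) atTop (𝓝 (partInf (φ n))) := by
  have h1 := ((summable_norm_unit null_le_conv (φ n)).of_norm.hasSum.tendsto_sum_nat).comp
    (tendsto_add_atTop_nat 1)
  refine (h1.sub (hφ n (tailOne 0))).congr fun m => ?_
  rw [Function.comp_apply, partialRow_apply,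
    Finset.sum_congr rfl fun k hk => hφ.tri_eq null_le_conv
      (Nat.lt_succ_iff.1 (Finset.mem_range.1 hk)),
    Finset.sum_sub_distrib, Finset.sum_comm]
  congr 1
  refine Finset.sum_congr rfl fun j hj => ?_
  rw [← Finset.sum_mul, mul_comm]
  congr 1
  change ∑ i ∈ Finset.range (j + 1), (fracDiff (-α) j i : ℂ) * (tailOne 0 : LP ∞) i = _
  simp only [tailOne_apply, Nat.not_lt_zero, if_false, mul_one]
  have hjm := Finset.mem_range.1 hj
  refine Finset.sum_subset (Finset.range_mono (by omega)) fun i _ hi => ?_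
  have : ¬i ≤ j := fun h => hi (Finset.mem_range.2 (by omega))
  simp [fracDiff, this]

theorem IsRows.gamExists (hφ : IsRows α A φ) : GamExists α A := fun n => ⟨_, hφ.tendsto_gam n⟩

theorem IsRows.gam_eq (hφ : IsRows α A φ) (n : ℕ) : gam α A n = partInf (φ n) :=
  (hφ.tendsto_gam n).limUnder_eq

theorem IsRows.enorm_eq (hφ : IsRows α A φ) (n : ℕ) :
    ‖φ n‖ₑ = norm1 (hat α A n) + ‖gam α A n‖ₑ := by
  rw [enorm_conv, hφ.gam_eq, show hat α A n = _ from funext (hφ.hat_eq null_le_conv n)]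

end RowsConv

/-- The truncation removes row `r` too, so the tail starts at `r + 1`; the shift does not affect the
limit. -/
theorem normInfInf_cut (M : Mat) (r : ℕ) : normInfInf (cut M r) = ⨆ n ≥ r + 1, norm1 (M n) := by
  refine iSup_congr fun n => ?_
  unfold cut
  split_ifs with h
  · simp [norm1, show ¬r + 1 ≤ n by omega]
  · simp [show r + 1 ≤ n by omega]

/-! ### The four target spaces -/

section Series

variable {α : ℝ} {A : Mat} {X : Submodule ℂ (LP ∞)}

theorem completeSpace_of_eq (hX : X = linf ∨ X = null) : CompleteSpace X := by
  rcases hX with rfl | rfl <;> infer_instance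

theorem null_le_of_eq (hX : X = linf ∨ X = null) : null ≤ X := by
  rcases hX with rfl | rfl
  · exact le_top
  · exact le_rfl

theorem IsRows.enorm_eq_norm1 {φ : ℕ → X →L[ℂ] ℂ} (hφ : IsRows α A φ) (hX : X = linf ∨ X = null)
    (n : ℕ) : ‖φ n‖ₑ = norm1 (hat α A n) := by
  rw [(hφ.isSeries hX (null_le_of_eq hX) n).enorm_eq,
    show hat α A n = _ from funext (hφ.hat_eq (null_le_of_eq hX) n)]

theorem series_into_linf (hX : X = linf ∨ X = null)
    (hA : A ∈ matClass (fracDomain α X) (seqs linf)) :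
    HatExists α A ∧ ChiBounded (matOp hA) ∧
      ∃ l : ℝ≥0, Tendsto (fun r : ℕ => ⨆ n ≥ r, norm1 (hat α A n)) atTop (𝓝 (l : ℝ≥0∞)) ∧
        0 ≤ chiNorm (matOp hA) ∧ chiNorm (matOp hA) ≤ l := by
  have := completeSpace_of_eq hX
  obtain ⟨φ, hφ⟩ := exists_isRows hA
  obtain ⟨h1, l, h2, h3⟩ := chiNorm_into_linf (opOn hA) φ (opOn_apply hA hφ)
  simp only [hφ.enorm_eq_norm1 hX] at h2
  rw [← chiNorm_matOp] at h3
  exact ⟨hφ.hatExists (null_le_of_eq hX), chiBounded_matOp h1, l, h2, h3⟩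

theorem series_into_null (hX : X = linf ∨ X = null)
    (hA : A ∈ matClass (fracDomain α X) (seqs null)) :
    HatExists α A ∧ ChiBounded (matOp hA) ∧
      ∃ l : ℝ≥0, Tendsto (fun r : ℕ => normInfInf (cut (hat α A) r)) atTop (𝓝 (l : ℝ≥0∞)) ∧
        chiNorm (matOp hA) = l := by
  have := completeSpace_of_eq hX
  obtain ⟨φ, hφ⟩ := exists_isRows hA
  obtain ⟨h1, l, h2, h3⟩ := chiNorm_into_null (opOn hA) φ (opOn_apply hA hφ)
  simp only [hφ.enorm_eq_norm1 hX] at h2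
  rw [← chiNorm_matOp] at h3
  refine ⟨hφ.hatExists (null_le_of_eq hX), chiBounded_matOp h1, l, ?_, h3⟩
  simp only [normInfInf_cut]
  exact h2.comp (tendsto_add_atTop_nat 1)

theorem exists_limit_rows {φ : ℕ → X →L[ℂ] ℂ} [CompleteSpace X] (hφ : IsRows α A φ)
    (hA : A ∈ matClass (fracDomain α X) (seqs conv)) :
    ∃ ψ : X →L[ℂ] ℂ, ∀ z, Tendsto (fun n => φ n z) atTop (𝓝 (ψ z)) :=
  exists_dual_of_tendsto φ fun z =>
    ⟨_, (tendsto_limCLM (opOn hA z)).congr fun n => opOn_apply hA hφ z n⟩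

theorem IsRows.tendsto_hat {φ : ℕ → X →L[ℂ] ℂ} (hφ : IsRows α A φ) (hX : null ≤ X)
    {ψ : X →L[ℂ] ℂ} (hψ : ∀ z, Tendsto (fun n => φ n z) atTop (𝓝 (ψ z))) (k : ℕ) :
    Tendsto (fun n => hat α A n k) atTop (𝓝 (ψ (unit hX k))) := by
  simp only [hφ.hat_eq hX]
  exact hψ _

theorem IsRows.hatB_eq {φ : ℕ → X →L[ℂ] ℂ} (hφ : IsRows α A φ) (hX : null ≤ X)
    {ψ : X →L[ℂ] ℂ} (hψ : ∀ z, Tendsto (fun n => φ n z) atTop (𝓝 (ψ z))) (n : ℕ) :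
    hatB α A n = fun k => (φ n - ψ) (unit hX k) := by
  ext k
  rw [hatB, hφ.hat_eq hX, sub_apply]
  congr 1
  exact (hφ.tendsto_hat hX hψ k).limUnder_eq

theorem series_into_conv (hX : X = linf ∨ X = null)
    (hA : A ∈ matClass (fracDomain α X) (seqs conv)) :
    HatExists α A ∧ HatLimExists α A ∧ ChiBounded (matOp hA) ∧
      ∃ l : ℝ≥0, Tendsto (fun r : ℕ => normInfInf (cut (hatB α A) r)) atTop (𝓝 (l : ℝ≥0∞)) ∧
        (1 / 2 : ℝ) * l ≤ chiNorm (matOp hA) ∧ chiNorm (matOp hA) ≤ l := by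
  have := completeSpace_of_eq hX
  have hX' := null_le_of_eq hX
  obtain ⟨φ, hφ⟩ := exists_isRows hA
  obtain ⟨ψ, hψ⟩ := exists_limit_rows hφ hA
  obtain ⟨h1, l, h2, h3⟩ := chiNorm_into_conv (opOn hA) φ (opOn_apply hA hφ) ψ hψ
  have hser := hφ.isSeries hX hX'
  -- The limit `ψ` of the rows is again given by a series, so `φ n - ψ` has no part invisible to the
  -- unit sequences.
  have e : ∀ n, ‖φ n - ψ‖ₑ = norm1 (hatB α A n) := fun n => by
    rw [((hser n).sub (isSeries_of_tendsto hX hX' hser hψ)).enorm_eq, hφ.hatB_eq hX' hψ]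
  simp only [e] at h2
  rw [← chiNorm_matOp] at h3
  refine ⟨hφ.hatExists hX', fun k => ⟨_, hφ.tendsto_hat hX' hψ k⟩, chiBounded_matOp h1, l, ?_, h3⟩
  simp only [normInfInf_cut]
  exact h2.comp (tendsto_add_atTop_nat 1)

theorem IsRows.sum_cut_hat {φ : ℕ → X →L[ℂ] ℂ} (hφ : IsRows α A φ) (hX : null ≤ X)
    (r : ℕ) (N : Finset ℕ) :
    ∑ n ∈ N, cut (hat α A) r n = fun k => (∑ n ∈ N, cut φ r n) (unit hX k) := by
  ext k
  rw [Finset.sum_apply, sum_apply]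
  refine Finset.sum_congr rfl fun n _ => ?_
  rw [cut_apply_clm]
  unfold cut
  split_ifs
  · rfl
  · exact hφ.hat_eq hX n k

theorem series_into_l1 (hX : X = linf ∨ X = null)
    (hA : A ∈ matClass (fracDomain α X) (seqs l1)) :
    HatExists α A ∧ ChiBounded (matOp hA) ∧
      ∃ l : ℝ≥0, Tendsto (fun r : ℕ => ⨆ N : Finset ℕ, norm1 (∑ n ∈ N, cut (hat α A) r n))
          atTop (𝓝 (l : ℝ≥0∞)) ∧
        (l : ℝ) ≤ chiNorm (matOp hA) ∧ chiNorm (matOp hA) ≤ 4 * l := by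
  have := completeSpace_of_eq hX
  have hX' := null_le_of_eq hX
  obtain ⟨φ, hφ⟩ := exists_isRows hA
  obtain ⟨h1, l, h2, h3⟩ := chiNorm_into_l1 (opOn hA) φ (opOn_apply hA hφ)
  have e : ∀ r (N : Finset ℕ), ‖∑ n ∈ N, cut φ r n‖ₑ = norm1 (∑ n ∈ N, cut (hat α A) r n) := by
    intro r N
    have hser : IsSeries hX' (∑ n ∈ N, cut φ r n) := by
      refine IsSeries.sum fun n _ => ?_
      unfold cut
      split_ifs
      · exact IsSeries.zero hX'
      · exact hφ.isSeries hX hX' n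
    rw [hser.enorm_eq, hφ.sum_cut_hat hX']
  simp only [e] at h2
  rw [← chiNorm_matOp] at h3
  exact ⟨hφ.hatExists hX', chiBounded_matOp h1, l, h2, h3⟩

end Series

/-! ### Operators on `c(Δ^(α))` -/

section Conv

variable {α : ℝ} {A : Mat}

theorem conv_into_linf (hA : A ∈ matClass (fracDomain α conv) (seqs linf)) :
    HatExists α A ∧ GamExists α A ∧ ChiBounded (matOp hA) ∧
      ∃ l : ℝ≥0, Tendsto (fun r : ℕ => ⨆ n ≥ r, (norm1 (hat α A n) + ‖gam α A n‖ₑ))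
          atTop (𝓝 (l : ℝ≥0∞)) ∧
        0 ≤ chiNorm (matOp hA) ∧ chiNorm (matOp hA) ≤ l := by
  obtain ⟨φ, hφ⟩ := exists_isRows hA
  obtain ⟨h1, l, h2, h3⟩ := chiNorm_into_linf (opOn hA) φ (opOn_apply hA hφ)
  simp only [hφ.enorm_eq] at h2
  rw [← chiNorm_matOp] at h3
  exact ⟨hφ.hatExists null_le_conv, hφ.gamExists, chiBounded_matOp h1, l, h2, h3⟩

theorem conv_into_null (hA : A ∈ matClass (fracDomain α conv) (seqs null)) :
    HatExists α A ∧ GamExists α A ∧ ChiBounded (matOp hA) ∧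
      ∃ l : ℝ≥0, Tendsto (fun r : ℕ => ⨆ n ≥ r, (norm1 (hat α A n) + ‖gam α A n‖ₑ))
          atTop (𝓝 (l : ℝ≥0∞)) ∧
        chiNorm (matOp hA) = l := by
  obtain ⟨φ, hφ⟩ := exists_isRows hA
  obtain ⟨h1, l, h2, h3⟩ := chiNorm_into_null (opOn hA) φ (opOn_apply hA hφ)
  simp only [hφ.enorm_eq] at h2
  rw [← chiNorm_matOp] at h3
  exact ⟨hφ.hatExists null_le_conv, hφ.gamExists, chiBounded_matOp h1, l, h2, h3⟩

theorem tendsto_seriesSum_unit (φ : conv →L[ℂ] ℂ) :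
    Tendsto (fun N => ∑ k ∈ Finset.range N, φ (unit null_le_conv k)) atTop
      (𝓝 (∑' k, φ (unit null_le_conv k))) :=
  (summable_norm_unit null_le_conv φ).of_norm.hasSum.tendsto_sum_nat

theorem seriesSum_unit (φ : conv →L[ℂ] ℂ) :
    seriesSum (fun k => φ (unit null_le_conv k)) = ∑' k, φ (unit null_le_conv k) :=
  (tendsto_seriesSum_unit φ).limUnder_eq

theorem conv_into_conv (hA : A ∈ matClass (fracDomain α conv) (seqs conv)) :
    HatExists α A ∧ GamExists α A ∧ HatLimExists α A ∧ BetExists α A ∧ ChiBounded (matOp hA) ∧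
      ∃ l : ℝ≥0, Tendsto (fun r : ℕ => ⨆ n ≥ r, (norm1 (hatB α A n) + ‖del α A n‖ₑ))
          atTop (𝓝 (l : ℝ≥0∞)) ∧
        (1 / 2 : ℝ) * l ≤ chiNorm (matOp hA) ∧ chiNorm (matOp hA) ≤ l := by
  obtain ⟨φ, hφ⟩ := exists_isRows hA
  obtain ⟨ψ, hψ⟩ := exists_limit_rows hφ hA
  obtain ⟨h1, l, h2, h3⟩ := chiNorm_into_conv (opOn hA) φ (opOn_apply hA hφ) ψ hψ
  have hhat : ∀ n, hat α A n = fun k => φ n (unit null_le_conv k) := fun n =>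
    funext (hφ.hat_eq null_le_conv n)
  have hlim : hatLim α A = fun k => ψ (unit null_le_conv k) :=
    funext fun k => (hφ.tendsto_hat null_le_conv hψ k).limUnder_eq
  -- By the definition of `partInf`, the difference is `φ n` at the constant sequence `1`; thus `β`
  -- is the value of `ψ` there, and `δ_n` is, up to sign, the part at infinity of `φ n - ψ`.
  have hbet : Tendsto (fun n => seriesSum (hat α A n) - gam α A n) atTop (𝓝 (ψ (tailOne 0))) := by
    refine (hψ (tailOne 0)).congr fun n => ?_
    rw [hφ.gam_eq, hhat, seriesSum_unit, partInf, sub_sub_cancel]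
  have hdel : ∀ n, del α A n = -partInf (φ n - ψ) := by
    intro n
    rw [del, hlim, seriesSum_unit, show bet α A = ψ (tailOne 0) from hbet.limUnder_eq, hφ.gam_eq,
      partInf_sub, partInf, partInf]
    ring
  have e : ∀ n, ‖φ n - ψ‖ₑ = norm1 (hatB α A n) + ‖del α A n‖ₑ := fun n => by
    rw [enorm_conv, hφ.hatB_eq null_le_conv hψ, hdel, enorm_neg]
  simp only [e] at h2
  rw [← chiNorm_matOp] at h3
  refine ⟨hφ.hatExists null_le_conv, hφ.gamExists,
    fun k => ⟨_, hφ.tendsto_hat null_le_conv hψ k⟩, ⟨fun n => ?_, ?_, _, hbet⟩,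
    chiBounded_matOp h1, l, h2, h3⟩
  · rw [hhat]
    exact ⟨_, tendsto_seriesSum_unit (φ n)⟩
  · rw [hlim]
    exact ⟨_, tendsto_seriesSum_unit ψ⟩

theorem conv_into_l1 (hA : A ∈ matClass (fracDomain α conv) (seqs l1)) :
    HatExists α A ∧ GamExists α A ∧ ChiBounded (matOp hA) ∧
      ∃ l : ℝ≥0, Tendsto (fun r : ℕ => ⨆ N : Finset ℕ,
          (norm1 (∑ n ∈ N, cut (hat α A) r n) + ‖∑ n ∈ N, cut (gam α A) r n‖ₑ))
          atTop (𝓝 (l : ℝ≥0∞)) ∧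
        (l : ℝ) ≤ chiNorm (matOp hA) ∧ chiNorm (matOp hA) ≤ 4 * l := by
  obtain ⟨φ, hφ⟩ := exists_isRows hA
  obtain ⟨h1, l, h2, h3⟩ := chiNorm_into_l1 (opOn hA) φ (opOn_apply hA hφ)
  have e : ∀ r (N : Finset ℕ), ‖∑ n ∈ N, cut φ r n‖ₑ =
      norm1 (∑ n ∈ N, cut (hat α A) r n) + ‖∑ n ∈ N, cut (gam α A) r n‖ₑ := by
    intro r N
    rw [enorm_conv, hφ.sum_cut_hat null_le_conv, partInf_sum]
    congr 2
    refine Finset.sum_congr rfl fun n _ => ?_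
    unfold cut
    split_ifs
    · simp [partInf]
    · exact (hφ.gam_eq n).symm
  simp only [e] at h2
  rw [← chiNorm_matOp] at h3
  exact ⟨hφ.hatExists null_le_conv, hφ.gamExists, chiBounded_matOp h1, l, h2, h3⟩

end Conv

end FracSeq

end

open FracSeq in
theorem mainTheorem1 (α : ℝ) (A : Mat) :
    -- from `ℓ_∞(Δ^(α))` or `c_0(Δ^(α))`
    (∀ X : Submodule ℂ (LP ∞), X = linf ∨ X = null →
      -- 1. into `ℓ_∞`
      (∀ hA : A ∈ matClass (fracDomain α X) (seqs linf),
        HatExists α A ∧ ChiBounded (matOp hA) ∧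
        ∃ l : ℝ≥0, Tendsto (fun r : ℕ => ⨆ n ≥ r, norm1 (hat α A n)) atTop (𝓝 (l : ℝ≥0∞)) ∧
          0 ≤ chiNorm (matOp hA) ∧ chiNorm (matOp hA) ≤ l) ∧
      -- 3. into `c_0`
      (∀ hA : A ∈ matClass (fracDomain α X) (seqs null),
        HatExists α A ∧ ChiBounded (matOp hA) ∧
        ∃ l : ℝ≥0, Tendsto (fun r : ℕ => normInfInf (cut (hat α A) r)) atTop (𝓝 (l : ℝ≥0∞)) ∧
          chiNorm (matOp hA) = l) ∧
      -- 5. into `c`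
      (∀ hA : A ∈ matClass (fracDomain α X) (seqs conv),
        HatExists α A ∧ HatLimExists α A ∧ ChiBounded (matOp hA) ∧
        ∃ l : ℝ≥0, Tendsto (fun r : ℕ => normInfInf (cut (hatB α A) r)) atTop (𝓝 (l : ℝ≥0∞)) ∧
          (1 / 2 : ℝ) * l ≤ chiNorm (matOp hA) ∧ chiNorm (matOp hA) ≤ l) ∧
      -- 7. into `ℓ_1`
      (∀ hA : A ∈ matClass (fracDomain α X) (seqs l1),
        HatExists α A ∧ ChiBounded (matOp hA) ∧
        ∃ l : ℝ≥0, Tendsto (fun r : ℕ => ⨆ N : Finset ℕ, norm1 (∑ n ∈ N, cut (hat α A) r n))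
            atTop (𝓝 (l : ℝ≥0∞)) ∧
          (l : ℝ) ≤ chiNorm (matOp hA) ∧ chiNorm (matOp hA) ≤ 4 * l)) ∧
    -- from `c(Δ^(α))`
    -- 2. into `ℓ_∞`
    (∀ hA : A ∈ matClass (fracDomain α conv) (seqs linf),
      HatExists α A ∧ GamExists α A ∧ ChiBounded (matOp hA) ∧
      ∃ l : ℝ≥0, Tendsto (fun r : ℕ => ⨆ n ≥ r, (norm1 (hat α A n) + ‖gam α A n‖ₑ))
          atTop (𝓝 (l : ℝ≥0∞)) ∧
        0 ≤ chiNorm (matOp hA) ∧ chiNorm (matOp hA) ≤ l) ∧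
    -- 4. into `c_0`
    (∀ hA : A ∈ matClass (fracDomain α conv) (seqs null),
      HatExists α A ∧ GamExists α A ∧ ChiBounded (matOp hA) ∧
      ∃ l : ℝ≥0, Tendsto (fun r : ℕ => ⨆ n ≥ r, (norm1 (hat α A n) + ‖gam α A n‖ₑ))
          atTop (𝓝 (l : ℝ≥0∞)) ∧
        chiNorm (matOp hA) = l) ∧
    -- 6. into `c`
    (∀ hA : A ∈ matClass (fracDomain α conv) (seqs conv),
      HatExists α A ∧ GamExists α A ∧ HatLimExists α A ∧ BetExists α A ∧ ChiBounded (matOp hA) ∧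
      ∃ l : ℝ≥0, Tendsto (fun r : ℕ => ⨆ n ≥ r, (norm1 (hatB α A n) + ‖del α A n‖ₑ))
          atTop (𝓝 (l : ℝ≥0∞)) ∧
        (1 / 2 : ℝ) * l ≤ chiNorm (matOp hA) ∧ chiNorm (matOp hA) ≤ l) ∧
    -- 8. into `ℓ_1`
    (∀ hA : A ∈ matClass (fracDomain α conv) (seqs l1),
      HatExists α A ∧ GamExists α A ∧ ChiBounded (matOp hA) ∧
      ∃ l : ℝ≥0, Tendsto (fun r : ℕ => ⨆ N : Finset ℕ,
          (norm1 (∑ n ∈ N, cut (hat α A) r n) + ‖∑ n ∈ N, cut (gam α A) r n‖ₑ))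
          atTop (𝓝 (l : ℝ≥0∞)) ∧
        (l : ℝ) ≤ chiNorm (matOp hA) ∧ chiNorm (matOp hA) ≤ 4 * l) := by
  exact ⟨fun _ hX => ⟨series_into_linf hX, series_into_null hX, series_into_conv hX,
    series_into_l1 hX⟩, conv_into_linf, conv_into_null, conv_into_conv, conv_into_l1⟩
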